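/- Let $X_1,X_2,\ldots$ be independent real random variables with a common continuous distribution function, and let $d\ge 0$ and $n\ge 0$ be integers. Call a finite sequence of reals $d$-modal if it is the concatenation of $d+1$ consecutive (possibly empty) monotone blocks that are alternately weakly increasing and weakly decreasing, beginning with an increasing block. (Thus $d=0$ means increasing, and $d=1$ means unimodal.) A feasible selection policy $\pi_n\in\Pi(n)$ decides for each $1\le i\le n$ whether to select $X_i$, the event that $X_i$ is selected belonging to $\sigma(X_1,\ldots,X_i)$, in such a way that the selected subsequence is always $d$-modal. Let $U^{o,d}_n(\pi_n)$ be the length of the selected subsequence. Theorem (Variance Bound for $d$-Modal Subsequences). There is a policy $\pi_n^*\in\Pi(n)$ with $E[U^{o,d}_n(\pi_n^*)]=\sup_{\pi_n\in\Pi(n)}E[U^{o,d}_n(\pi_n)]$; it is unique in the sense that any two such policies almost surely select the same observations; and it satisfies $$\operatorname{Var}[U^{o,d}_n(\pi^*_n)]\le E[U^{o,d}_n(\pi^*_n)].$$ Moreover, for the sequence of optimal policies $\pi_n^*\in\Pi(n)$, the weak law $$\frac{U^{o,d}_n(\pi^*_n)}{\sqrt n}\longrightarrow \sqrt{2(d+1)}\quad\text{in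 probability as } n\to\infty$$ holds. -/

import Mathlib

open MeasureTheory ProbabilityTheory Filter Topology

/-- `X` is a family of independent real random variables on `(Ω, P)`, all with the distribution
function `F`. -/
structure IsIIDSample {Ω : Type*} [MeasurableSpace Ω] {ι : Type*}
    (X : ι → Ω → ℝ) (F : ℝ → ℝ) (P : Measure Ω) : Prop where
  measurable : ∀ i, Measurable (X i)
  indep : iIndepFun X P
  cdf_eq : ∀ i x, P.real {ω | X i ω ≤ x} = F x

/-- The subsequence `(x i)_{i ∈ A}` of `x 0, …, x (n - 1)` is `d`-modal: it is the concatenation of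
`d + 1` consecutive blocks, numbered `0, …, d` and possibly empty, those with an even number being
(weakly) increasing and those with an odd number being (weakly) decreasing. The map `b` gives the
number of the block to which an index belongs. For `d = 0` this says that the subsequence is
increasing, for `d = 1` that it is unimodal. -/
def IsDModal (d : ℕ) {n : ℕ} (x : Fin n → ℝ) (A : Set (Fin n)) : Prop :=
  ∃ b : Fin n → Fin (d + 1), Monotone b ∧
    ∀ r : Fin (d + 1),
      (Even (r : ℕ) → MonotoneOn x (A ∩ b ⁻¹' {r})) ∧
      (Odd (r : ℕ) → AntitoneOn x (A ∩ b ⁻¹' {r}))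

/-- A feasible policy for the sequential selection of a `d`-modal subsequence of
`X 0, …, X (n - 1)`. Here `select i` is the event that `X i` is selected. It has to be decided
by the observations up to and including `X i` (equivalently, the successive selection times are
stopping times for the filtration generated by the observations), and the selected subsequence
has to be `d`-modal. -/
structure SelectionPolicy {Ω : Type*} {n : ℕ} (X : Fin n → Ω → ℝ) (d : ℕ) where
  select : Fin n → Set Ω
  nonanticipating : ∀ i : Fin n,
    MeasurableSet[⨆ j : Fin n, ⨆ _ : j ≤ i, MeasurableSpace.comap (X j) inferInstance] (select i)
  feasible : ∀ ω, IsDModal d (fun i => X i ω) {i | ω ∈ select i}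

namespace SelectionPolicy

/-- The length of the selected subsequence. -/
noncomputable def length {Ω : Type*} {n : ℕ} {X : Fin n → Ω → ℝ} {d : ℕ}
    (π : SelectionPolicy X d) (ω : Ω) : ℕ :=
  {i : Fin n | ω ∈ π.select i}.ncard

/-- `π` maximizes the expected length of the selected subsequence among all feasible policies. -/
def IsOptimal {Ω : Type*} [MeasurableSpace Ω] {n : ℕ} {X : Fin n → Ω → ℝ} {d : ℕ}
    (π : SelectionPolicy X d) (P : Measure Ω) : Prop :=
  ∀ π' : SelectionPolicy X d, ∫ ω, (π'.length ω : ℝ) ∂P ≤ ∫ ω, (π.length ω : ℝ) ∂P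

end SelectionPolicy

/-!
A monotone function of the observations keeps feasible selections feasible, so the continuous
distribution function `F` allows replacing the observations by `F (X i)`, which are uniform on
`[0, 1]` (`map_comp_cdf`). What matters of a selection is then its state `(r, s)`: the number `r`
of turns made, counted greedily (`state_fst_le_of_isDModal`), and the progress `s ∈ [0, 1]` inside
the current block. The Bellman recursion `value` over these states depends on nothing but `d`.

The number of selections so far plus the value of the current state is a supermartingale whose
conditional drift is minus the loss of the decision taken (`IsUniformStream.integral_count`). Hence a
policy is optimal if and only if almost surely it never loses. Since `value` is strictly decreasing
along the blocks as soon as it is not constant (`value_strictAntiOn`), selecting and rejecting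
almost surely have different values, and the optimal decisions are unique
(`IsUniformStream.ae_mem_iff`). The policy taking them, except on the null event of equal uniform
values, exists and is feasible for the original observations (`isDModal_of_state`).

For an optimal policy the potential is a martingale. An optimal selection changes the value of
the state by an amount between `-1` and `0`, so each increment differs by a conditional constant
from a variable between `0` and the indicator of a selection. Its conditional variance is therefore at most the conditional
probability of a selection, and summation gives the variance bound
(`IsUniformStream.variance_count_le`).

For the weak law, by Chebyshev's inequality it remains to prove `value d n (0, 0) ∼ √(2 (d + 1) n)`.
The upper bound comes from the linear supersolutions `l * L + k / (2 * l)` of the Bellman equation,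
where `L = d + 1 - r - s` is the remaining length (`value_le_linear`); the lower bound comes from
the subsolutions that belong to selecting the observations within a fixed small distance
(`subsolution_le_value`).
-/

namespace DModal

open Set

/-! ### The selection state and its value function -/

/-- The uniform distribution on `[0, 1]`. -/
noncomputable abbrev unif : Measure ℝ := volume.restrict (Icc (0 : ℝ) 1)

instance : IsProbabilityMeasure unif := ⟨by simp [unif]⟩

/-- The state after a selection. A state `(r, s)` means that block number `r` is the current one
and that its last value is `s`, values being read upside down (`u ↦ 1 - u`) in decreasing blocks;
so a further value `u`, read in the same way, continues the block when `s ≤ u` and otherwise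
opens the next block, where it reads `1 - u`. -/
noncomputable def move (z : ℕ × ℝ) (u : ℝ) : ℕ × ℝ :=
  if z.2 ≤ u then (z.1, u) else (z.1 + 1, 1 - u)

/-- The Bellman value: the maximal expected number of further selections from the state `z` when
`k` independent uniform observations are to come. A state that has used more than `d + 1` blocks
is given the value `-2`, so small that it never pays to enter it. -/
noncomputable def value (d : ℕ) : ℕ → ℕ × ℝ → ℝ
  | 0, z => if z.1 ≤ d then 0 else -2
  | k + 1, z => if z.1 ≤ d then ∫ u, max (value d k z) (1 + value d k (move z u)) ∂unif else -2

lemma move_of_le {r : ℕ} {s u : ℝ} (h : s ≤ u) : move (r, s) u = (r, u) := if_pos h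

lemma move_of_lt {r : ℕ} {s u : ℝ} (h : u < s) : move (r, s) u = (r + 1, 1 - u) :=
  if_neg h.not_ge

lemma measurable_move : Measurable fun p : (ℕ × ℝ) × ℝ => move p.1 p.2 := by
  unfold move
  refine Measurable.ite (measurableSet_le (by fun_prop) (by fun_prop)) (by fun_prop) ?_
  exact ((measurable_of_countable fun r : ℕ => r + 1).comp (by fun_prop)).prodMk (by fun_prop)

lemma measurable_value (d k : ℕ) : Measurable (value d k) := by
  have hd : MeasurableSet {z : ℕ × ℝ | z.1 ≤ d} :=
    measurable_fst (MeasurableSet.of_discrete (s := {r : ℕ | r ≤ d}))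
  induction k with
  | zero => exact Measurable.ite hd measurable_const measurable_const
  | succ k ih =>
    refine Measurable.ite hd ?_ measurable_const
    have h : Measurable fun p : (ℕ × ℝ) × ℝ =>
        max (value d k p.1) (1 + value d k (move p.1 p.2)) :=
      (ih.comp measurable_fst).max ((ih.comp measurable_move).const_add 1)
    exact (StronglyMeasurable.integral_prod_right
      (f := fun z u => max (value d k z) (1 + value d k (move z u)))
      h.stronglyMeasurable).measurable

lemma value_of_lt {d : ℕ} (k : ℕ) {z : ℕ × ℝ} (h : d < z.1) : value d k z = -2 := by
  cases k <;> simp [value, h.not_ge]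

lemma value_zero {d : ℕ} {z : ℕ × ℝ} (h : z.1 ≤ d) : value d 0 z = 0 := by simp [value, h]

lemma value_succ {d : ℕ} (k : ℕ) {z : ℕ × ℝ} (h : z.1 ≤ d) :
    value d (k + 1) z = ∫ u, max (value d k z) (1 + value d k (move z u)) ∂unif := by
  simp [value, h]

lemma integrable_unif {φ : ℝ → ℝ} (hφ : Measurable φ) {C : ℝ} (hC : ∀ u, |φ u| ≤ C) :
    Integrable φ unif :=
  Integrable.of_bound hφ.aestronglyMeasurable C (Eventually.of_forall hC)

lemma measurable_bellman (d k : ℕ) (z : ℕ × ℝ) :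
    Measurable fun u => max (value d k z) (1 + value d k (move z u)) :=
  measurable_const.max (((measurable_value d k).comp
    (measurable_move.comp (measurable_const.prodMk measurable_id))).const_add 1)

lemma value_bounds (d k : ℕ) :
    (∀ z : ℕ × ℝ, -2 ≤ value d k z ∧ value d k z ≤ k) ∧
      ∀ z : ℕ × ℝ, z.1 ≤ d → 0 ≤ value d k z := by
  induction k with
  | zero =>
    refine ⟨fun z => ?_, fun z hz => (value_zero hz).ge⟩
    by_cases h : z.1 ≤ d <;> simp [value, h]
  | succ k ih =>
    have key : ∀ z : ℕ × ℝ, z.1 ≤ d → 0 ≤ value d (k + 1) z ∧ value d (k + 1) z ≤ k + 1 := by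
      intro z hz
      rw [value_succ k hz]
      have h0 : ∀ u, 0 ≤ max (value d k z) (1 + value d k (move z u)) :=
        fun u => le_max_of_le_left (ih.2 z hz)
      have h1 : ∀ u, max (value d k z) (1 + value d k (move z u)) ≤ k + 1 := fun u =>
        max_le (by linarith [(ih.1 z).2]) (by linarith [(ih.1 (move z u)).2])
      refine ⟨integral_nonneg h0, ?_⟩
      calc _ ≤ ∫ _, ((k : ℝ) + 1) ∂unif := integral_mono
            (integrable_unif (measurable_bellman d k z) (C := k + 1)
              fun u => by rw [abs_of_nonneg (h0 u)]; exact h1 u) (integrable_const _) h1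
        _ = _ := by simp
    refine ⟨fun z => ?_, fun z hz => (key z hz).1⟩
    by_cases hz : z.1 ≤ d
    · push_cast
      constructor <;> linarith [key z hz]
    · rw [value_of_lt _ (not_le.mp hz)]
      push_cast
      constructor <;> linarith [(Nat.cast_nonneg k : (0 : ℝ) ≤ k)]

lemma value_nonneg {d : ℕ} (k : ℕ) {z : ℕ × ℝ} (h : z.1 ≤ d) : 0 ≤ value d k z :=
  (value_bounds d k).2 z h

lemma abs_value_le (d k : ℕ) (z : ℕ × ℝ) : |value d k z| ≤ k + 2 := by
  rw [abs_le]
  constructor <;> linarith [(value_bounds d k).1 z, (Nat.cast_nonneg k : (0 : ℝ) ≤ k)]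

lemma abs_bellman_le (d k : ℕ) (z z' : ℕ × ℝ) :
    |max (value d k z) (1 + value d k z')| ≤ k + 3 := by
  have h := abs_le.mp (abs_value_le d k z)
  have h' := abs_le.mp (abs_value_le d k z')
  rw [abs_le]
  exact ⟨le_max_of_le_left (by linarith [h.1]), max_le (by linarith [h.2]) (by linarith [h'.2])⟩

lemma integrable_bellman (d k : ℕ) (z : ℕ × ℝ) :
    Integrable (fun u => max (value d k z) (1 + value d k (move z u))) unif :=
  integrable_unif (measurable_bellman d k z) fun _ => abs_bellman_le d k _ _

lemma measurePreserving_one_sub : MeasurePreserving (fun u : ℝ => 1 - u) unif unif := by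
  have h : MeasurePreserving (fun u : ℝ => 1 - u) volume volume :=
    Measure.measurePreserving_sub_left volume (1 : ℝ)
  have := h.restrict_preimage (measurableSet_Icc (a := (0 : ℝ)) (b := 1))
  simpa using this

lemma integral_one_sub (φ : ℝ → ℝ) : ∫ u, φ (1 - u) ∂unif = ∫ u, φ u ∂unif :=
  measurePreserving_one_sub.integral_comp
    (Homeomorph.subLeft (1 : ℝ)).measurableEmbedding φ

lemma ae_unif_mem : ∀ᵐ u ∂unif, u ∈ Ioo (0 : ℝ) 1 := by
  rw [unif, ← restrict_Ioo_eq_restrict_Icc]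
  exact ae_restrict_mem measurableSet_Ioo

/-- A block whose last value is extreme is as good as the next block before its first value. -/
lemma value_one_eq {d r : ℕ} (k : ℕ) (h : r < d) : value d k (r, 1) = value d k (r + 1, 0) := by
  induction k with
  | zero => rw [value_zero (by exact h.le), value_zero (by exact h)]
  | succ k ih =>
    rw [value_succ k (by exact h.le), value_succ k (by exact h), ih,
      ← integral_one_sub fun u => max _ (1 + value d k (move (r + 1, 0) u))]
    refine integral_congr_ae ?_
    filter_upwards [ae_unif_mem] with u hu
    rw [move_of_lt hu.2, move_of_le (by linarith [hu.2])]

/-- The comparison behind monotonicity: an observation that opens a new block when the last value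
is `s'` but continues the block when it is `s` leads to a better state in the latter case. -/
lemma value_move_antitone_of {d k : ℕ}
    (H : ∀ r, ∀ s s' : ℝ, 0 ≤ s → s ≤ s' → s' ≤ 1 → value d k (r, s') ≤ value d k (r, s))
    (r : ℕ) {s s' u : ℝ} (hs : s ≤ s') (hu : u ∈ Icc (0 : ℝ) 1) :
    value d k (move (r, s') u) ≤ value d k (move (r, s) u) := by
  rcases lt_or_ge u s with h | h
  · rw [move_of_lt h, move_of_lt (h.trans_le hs)]
  rcases lt_or_ge u s' with h' | h'
  · rw [move_of_le h, move_of_lt h']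
    rcases Nat.lt_or_ge r d with hr | hr
    · calc value d k (r + 1, 1 - u) ≤ value d k (r + 1, 0) :=
            H _ _ _ le_rfl (by linarith [hu.2]) (by linarith [hu.1])
        _ = value d k (r, 1) := (value_one_eq k hr).symm
        _ ≤ _ := H _ _ _ hu.1 hu.2 le_rfl
    · rw [value_of_lt _ (by simpa using Nat.lt_succ_of_le hr)]
      exact ((value_bounds d k).1 _).1
  · rw [move_of_le h, move_of_le h']

lemma value_antitone (d k : ℕ) :
    ∀ r, ∀ s s' : ℝ, 0 ≤ s → s ≤ s' → s' ≤ 1 → value d k (r, s') ≤ value d k (r, s) := by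
  induction k with
  | zero => intro r s s' _ _ _; simp [value]
  | succ k ih =>
    intro r s s' h0 hs h1
    by_cases hr : r ≤ d
    swap
    · rw [value_of_lt _ (not_le.mp hr), value_of_lt _ (not_le.mp hr)]
    rw [value_succ k (by exact hr), value_succ k (by exact hr)]
    refine integral_mono_ae (integrable_bellman d k _) (integrable_bellman d k _) ?_
    filter_upwards [ae_unif_mem] with u hu
    exact max_le_max (ih r s s' h0 hs h1)
      (add_le_add le_rfl (value_move_antitone_of ih r hs (Ioo_subset_Icc_self hu)))

/-- Making a selection never improves the state. -/
lemma value_move_le (d k : ℕ) {z : ℕ × ℝ} {u : ℝ} (hz : z.2 ∈ Icc (0 : ℝ) 1)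
    (hu : u ∈ Icc (0 : ℝ) 1) : value d k (move z u) ≤ value d k z := by
  obtain ⟨r, s⟩ := z
  simp only at hz
  rcases lt_or_ge u s with h | h
  · rw [move_of_lt h]
    rcases lt_or_ge r d with hr | hr
    · calc value d k (r + 1, 1 - u) ≤ value d k (r + 1, 0) :=
            value_antitone d k _ _ _ le_rfl (by linarith [hu.2]) (by linarith [hu.1])
        _ = value d k (r, 1) := (value_one_eq k hr).symm
        _ ≤ _ := value_antitone d k _ _ _ hz.1 hz.2 le_rfl
    · rw [value_of_lt _ (by simpa using Nat.lt_succ_of_le hr)]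
      exact ((value_bounds d k).1 _).1
  · rw [move_of_le h]
    exact value_antitone d k _ _ _ hz.1 h hu.2

/-- When there are no more observations to come than turns left, all of them can be selected. -/
lemma value_eq_of_le {d k r : ℕ} (h : k + r ≤ d) (s : ℝ) : value d k (r, s) = k := by
  induction k generalizing r s with
  | zero => rw [value_zero (by simpa using h)]; simp
  | succ k ih =>
    rw [value_succ k (show r ≤ d by omega)]
    have : ∀ u, max (value d k (r, s)) (1 + value d k (move (r, s) u)) = k + 1 := by
      intro u
      have : value d k (move (r, s) u) = k := by
        rcases lt_or_ge u s with h' | h'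
        · rw [move_of_lt h', ih (by omega)]
        · rw [move_of_le h', ih (by omega)]
      rw [this, ih (by omega), max_eq_right (by linarith), add_comm]
    simp [this]

/-- With more observations to come than turns left, progress inside the block is costly. -/
lemma value_strictAntiOn {d k : ℕ} :
    ∀ r ≤ d, d < k + r → StrictAntiOn (fun s => value d k (r, s)) (Icc 0 1) := by
  induction k with
  | zero => intro r hr h; omega
  | succ k ih =>
    intro r hr h s hs s' hs' hss
    change value d (k + 1) (r, s') < value d (k + 1) (r, s)
    -- strict gain on values that continue the block from `s` but not from `s'`
    have key : ∀ u ∈ Ioo s s', max (value d k (r, s')) (1 + value d k (move (r, s') u)) <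
        max (value d k (r, s)) (1 + value d k (move (r, s) u)) := by
      intro u hu
      have hu01 : u ∈ Icc (0 : ℝ) 1 := ⟨hs.1.trans hu.1.le, hu.2.le.trans hs'.2⟩
      have hu1 : u < 1 := hu.2.trans_le hs'.2
      rw [move_of_le hu.1.le, move_of_lt hu.2]
      have hturn : value d k (r + 1, 1 - u) < value d k (r, u) := by
        rcases hr.lt_or_eq with hr' | rfl
        · calc value d k (r + 1, 1 - u) < value d k (r + 1, 0) :=
                ih (r + 1) hr' (by omega) ⟨le_rfl, zero_le_one⟩
                  ⟨by linarith, by linarith [hu01.1]⟩ (by linarith)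
            _ = value d k (r, 1) := (value_one_eq k hr').symm
            _ ≤ _ := value_antitone d k _ _ _ hu01.1 hu01.2 le_rfl
        · rw [value_of_lt _ (by simp)]
          linarith [value_nonneg k (show ((r, u) : ℕ × ℝ).1 ≤ r from le_rfl)]
      rcases lt_or_ge d (k + r) with hk | hk
      · exact max_lt_max (ih r hr hk hs hs' hss) (by linarith)
      · rw [value_eq_of_le hk, value_eq_of_le hk, value_eq_of_le hk] at *
        refine lt_max_of_lt_right (max_lt (by linarith) (by linarith))
    rw [value_succ k (by exact hr), value_succ k (by exact hr)]
    have hle : ∀ᵐ u ∂unif, max (value d k (r, s')) (1 + value d k (move (r, s') u)) ≤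
        max (value d k (r, s)) (1 + value d k (move (r, s) u)) := by
      filter_upwards [ae_unif_mem] with u hu
      exact max_le_max (value_antitone d k _ _ _ hs.1 hss.le hs'.2) (add_le_add le_rfl
        (value_move_antitone_of (value_antitone d k) r hss.le (Ioo_subset_Icc_self hu)))
    refine lt_of_le_of_ne
      (integral_mono_ae (integrable_bellman d k _) (integrable_bellman d k _) hle) fun heq => ?_
    have hae := (integral_eq_iff_of_ae_le (integrable_bellman d k _)
      (integrable_bellman d k _) hle).mp heq
    have hnull : unif (Ioo s s') = 0 :=
      measure_mono_null (fun u hu heq => (key u hu).ne heq) (ae_iff.mp hae)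
    rw [unif, Measure.restrict_apply measurableSet_Ioo, inter_eq_left.mpr
      (Ioo_subset_Icc_self.trans (Icc_subset_Icc hs.1 hs'.2)), Real.volume_Ioo] at hnull
    simp only [ENNReal.ofReal_eq_zero] at hnull
    linarith

/-- Indifference between selecting and rejecting has probability zero. -/
lemma ae_value_ne (d k : ℕ) {z : ℕ × ℝ} (hz : z.1 ≤ d) :
    ∀ᵐ u ∂unif, 1 + value d k (move z u) ≠ value d k z := by
  obtain ⟨r, s⟩ := z
  -- a strictly decreasing function takes the value in question at most once
  have hcount : ∀ r' ≤ d, d < k + r' → ∀ c : ℝ, ∀ᵐ u ∂unif, value d k (r', u) ≠ c := by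
    intro r' hr' hk c
    have hsub : ({u | value d k (r', u) = c} ∩ Icc 0 1).Subsingleton := fun u hu v hv =>
      (value_strictAntiOn r' hr' hk).injOn hu.2 hv.2 (hu.1.trans hv.1.symm)
    rw [ae_iff, unif, Measure.restrict_apply' measurableSet_Icc]
    simpa using hsub.measure_zero volume
  have hcont : ∀ᵐ u ∂unif, 1 + value d k (r, u) ≠ value d k (r, s) := by
    rcases lt_or_ge d (k + r) with hk | hk
    · filter_upwards [hcount r hz hk (value d k (r, s) - 1)] with u hu h
      exact hu (by linarith)
    · refine Eventually.of_forall fun u => ?_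
      rw [value_eq_of_le hk, value_eq_of_le hk]
      linarith
  have hturn : ∀ᵐ u ∂unif, 1 + value d k (r + 1, 1 - u) ≠ value d k (r, s) := by
    rcases Nat.lt_or_ge r d with hr | hr
    · rcases lt_or_ge d (k + (r + 1)) with hk | hk
      · have := measurePreserving_one_sub.quasiMeasurePreserving.ae
          (hcount (r + 1) hr hk (value d k (r, s) - 1))
        filter_upwards [this] with u hu h
        exact hu (by linarith)
      · refine Eventually.of_forall fun u => ?_
        rw [value_eq_of_le hk, value_eq_of_le (by omega)]
        linarith
    · refine Eventually.of_forall fun u h => ?_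
      rw [value_of_lt _ (by simpa using Nat.lt_succ_of_le hr)] at h
      linarith [value_nonneg k hz]
  filter_upwards [hcont, hturn] with u h1 h2
  rcases lt_or_ge u s with h | h
  · rwa [move_of_lt h]
  · rwa [move_of_le h]

/-! ### Growth of the value function -/

lemma integral_unif (φ : ℝ → ℝ) : ∫ u, φ u ∂unif = ∫ u in (0 : ℝ)..1, φ u := by
  rw [intervalIntegral.integral_of_le zero_le_one, unif, integral_Icc_eq_integral_Ioc]

lemma integral_hinge_le {l : ℝ} (hl : 0 < l) :
    ∫ y in (0 : ℝ)..1, max 0 (1 - l * y) ≤ 1 / (2 * l) := by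
  have hint : ∀ a b : ℝ, IntervalIntegrable (fun y => max 0 (1 - l * y)) volume a b :=
    fun a b => (by fun_prop : Continuous fun y : ℝ => max 0 (1 - l * y)).intervalIntegrable a b
  obtain ⟨c, hc⟩ : ∃ c, c = min 1 (1 / l) := ⟨_, rfl⟩
  have hc0 : 0 ≤ c := by rw [hc]; positivity
  have hc1 : c ≤ 1 := hc ▸ min_le_left _ _
  have hcl : l * c ≤ 1 := by
    rw [mul_comm, ← le_div_iff₀ hl]; exact hc ▸ min_le_right _ _
  have h1 : ∫ y in (0 : ℝ)..c, max 0 (1 - l * y) = c - l * (c ^ 2 / 2) := by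
    rw [intervalIntegral.integral_congr (g := fun y => 1 - l * y)]
    · rw [intervalIntegral.integral_sub (by simp) (by
        exact (by fun_prop : Continuous fun y : ℝ => l * y).intervalIntegrable _ _)]
      rw [intervalIntegral.integral_const_mul]
      simp
    · intro y hy
      rw [uIcc_of_le hc0] at hy
      refine max_eq_right ?_
      nlinarith [mul_le_mul_of_nonneg_left hy.2 hl.le]
  have h2 : ∫ y in c..1, max 0 (1 - l * y) = 0 := by
    rcases min_choice 1 (1 / l) with h | h
    · rw [hc, h, intervalIntegral.integral_same]
    · rw [intervalIntegral.integral_congr (g := fun _ => 0)]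
      · simp
      · intro y hy
        rw [uIcc_of_le hc1, hc, h] at hy
        have := (div_le_iff₀ hl).mp hy.1
        exact max_eq_left (by linarith)
  rw [← intervalIntegral.integral_add_adjacent_intervals (hint 0 c) (hint c 1), h1, h2,
    le_div_iff₀ (by positivity)]
  nlinarith [sq_nonneg (1 - l * c)]

/-- Linear functions are supersolutions of the Bellman equation: from a state with length
`d + 1 - r - s` left, the possible moves lie at distances that are at least as large as those of
a uniform observation in a single increasing sequence. -/
lemma value_le_linear (d : ℕ) {l : ℝ} (hl : 0 < l) (k : ℕ) :
    ∀ r ≤ d, ∀ s ∈ Icc (0 : ℝ) 1,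
      value d k (r, s) ≤ l * (d + 1 - r - s) + k * (1 / (2 * l)) := by
  induction k with
  | zero =>
    intro r hr s hs
    rw [value_zero (by exact hr)]
    have : (r : ℝ) ≤ d := by exact_mod_cast hr
    have : 0 ≤ l * (d + 1 - r - s) := mul_nonneg hl.le (by linarith [hs.2])
    simpa using this
  | succ k ih =>
    intro r hr s hs
    obtain ⟨h, hh⟩ : ∃ h, h = l * (d + 1 - r - s) + k * (1 / (2 * l)) := ⟨_, rfl⟩
    have hr' : (r : ℝ) ≤ d := by exact_mod_cast hr
    have hh0 : 0 ≤ h := by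
      have : 0 ≤ l * (d + 1 - r - s) := mul_nonneg hl.le (by linarith [hs.2])
      rw [hh]; positivity
    let ψ : ℝ → ℝ := fun y => max 0 (1 - l * y)
    have hψ : Continuous ψ := by fun_prop
    let φ : ℝ → ℝ := fun u => if s ≤ u then ψ (u - s) else ψ (1 - u)
    have hφm : Measurable φ := Measurable.ite measurableSet_Ici (by fun_prop) (by fun_prop)
    have hψ0 : ∀ y, 0 ≤ ψ y := fun y => le_max_left _ _
    have hφi : ∀ a b, IntervalIntegrable φ volume a b := by
      intro a b
      have h1 : IntervalIntegrable (fun u => ψ (u - s)) volume a b :=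
        (by fun_prop : Continuous fun u => ψ (u - s)).intervalIntegrable a b
      have h2 : IntervalIntegrable (fun u => ψ (1 - u)) volume a b :=
        (by fun_prop : Continuous fun u => ψ (1 - u)).intervalIntegrable a b
      refine (h1.add h2).mono_fun hφm.aestronglyMeasurable (Eventually.of_forall fun u => ?_)
      have hφ0 : 0 ≤ φ u := by dsimp only [φ]; split_ifs <;> exact hψ0 _
      simp only [Real.norm_eq_abs]
      rw [abs_of_nonneg hφ0, abs_of_nonneg (add_nonneg (hψ0 _) (hψ0 _))]
      dsimp only [φ]
      split_ifs
      · linarith [hψ0 (1 - u)]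
      · linarith [hψ0 (u - s)]
    have hφint : ∫ u, φ u ∂unif = ∫ y in (0 : ℝ)..1, ψ y := by
      have h1 : ∫ u in (0 : ℝ)..s, φ u = ∫ y in (1 - s)..1, ψ y := by
        have : ∫ u in (0 : ℝ)..s, φ u = ∫ u in (0 : ℝ)..s, ψ (1 - u) := by
          refine intervalIntegral.integral_congr_ae ?_
          filter_upwards [measure_eq_zero_iff_ae_notMem.mp
            (measure_singleton (μ := (volume : Measure ℝ)) s)] with u hu hus
          rw [uIoc_of_le hs.1] at hus
          exact if_neg (not_le.mpr (lt_of_le_of_ne hus.2 hu))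
        rw [this, intervalIntegral.integral_comp_sub_left ψ 1, sub_zero]
      have h2 : ∫ u in s..1, φ u = ∫ y in (0 : ℝ)..(1 - s), ψ y := by
        have : ∫ u in s..1, φ u = ∫ u in s..1, ψ (u - s) := by
          refine intervalIntegral.integral_congr fun u hu => ?_
          rw [uIcc_of_le hs.2] at hu
          exact if_pos hu.1
        rw [this, intervalIntegral.integral_comp_sub_right ψ s, sub_self]
      rw [integral_unif, ← intervalIntegral.integral_add_adjacent_intervals (hφi 0 s) (hφi s 1),
        h1, h2, add_comm, intervalIntegral.integral_add_adjacent_intervals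
          (hψ.intervalIntegrable _ _) (hψ.intervalIntegrable _ _)]
    have hφI : Integrable φ unif := by
      have := (intervalIntegrable_iff_integrableOn_Icc_of_le zero_le_one).mp (hφi 0 1)
      exact this
    calc value d (k + 1) (r, s)
        = ∫ u, max (value d k (r, s)) (1 + value d k (move (r, s) u)) ∂unif := value_succ k hr
      _ ≤ ∫ u, (h + φ u) ∂unif := by
          refine integral_mono_ae (integrable_bellman d k _) ((integrable_const h).add hφI) ?_
          filter_upwards [ae_unif_mem] with u hu
          have hφ0 : 0 ≤ φ u := by dsimp only [φ]; split_ifs <;> exact hψ0 _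
          refine max_le (by linarith [hh ▸ ih r hr s hs]) ?_
          rcases lt_or_ge u s with h' | h'
          · rw [move_of_lt h']
            rcases hr.lt_or_eq with hrd | rfl
            · have := ih (r + 1) hrd (1 - u) ⟨by linarith [hu.2], by linarith [hu.1]⟩
              have hφu : 1 - l * (1 - u) ≤ φ u := by
                simp only [φ, if_neg h'.not_ge, ψ]; exact le_max_right _ _
              push_cast at this
              nlinarith [mul_nonneg hl.le (sub_nonneg.mpr hs.2)]
            · rw [value_of_lt _ (by simp)]
              linarith
          · rw [move_of_le h']
            have := ih r hr u (Ioo_subset_Icc_self hu)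
            have hφu : 1 - l * (u - s) ≤ φ u := by
              simp only [φ, if_pos h', ψ]; exact le_max_right _ _
            rw [hh]
            linarith
      _ = h + ∫ y in (0 : ℝ)..1, ψ y := by
          rw [integral_add (integrable_const h) hφI, hφint]; simp
      _ ≤ h + 1 / (2 * l) := by linarith [integral_hinge_le hl]
      _ = _ := by rw [hh]; push_cast; ring

/-- Subsolutions of the Bellman equation. They come from the policy that selects the observations
advancing by at most `δ`: from `(r, s)` it makes on average `δ * k` selections in `k` steps, and
the squared positive part penalizes the chance of running out of room. The part of each block
within `δ` of its end is skipped, whence the term `- δ * r`. -/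
lemma subsolution_le_value (d : ℕ) {δ η c B : ℝ} (n : ℕ) (hδ : 0 < δ) (hδ1 : δ ≤ 1) (hη : 0 < η)
    (hc : c + η ≤ (d + 1) * (1 - δ)) (hB : δ * n ≤ B * η ^ 2) (hB0 : 0 ≤ B) (k : ℕ) :
    k ≤ n → ∀ r ≤ d, ∀ s ∈ Icc (0 : ℝ) 1,
      δ * k - B * (max 0 (r + s - δ * r + k * δ ^ 2 / 2 - c) ^ 2 + k * δ ^ 3 / 3)
        ≤ value d k (r, s) := by
  induction k with
  | zero =>
    intro _ r hr s hs
    rw [value_zero (by exact hr)]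
    have : 0 ≤ B * max 0 (r + s - δ * r + (0 : ℕ) * δ ^ 2 / 2 - c) ^ 2 := by positivity
    push_cast at *
    linarith
  | succ k ih =>
    intro hk
    have ih := ih (Nat.le_of_succ_le hk)
    -- away from the end of a block, one step of the policy
    have main : ∀ r ≤ d, ∀ s ∈ Icc (0 : ℝ) (1 - δ),
        δ * (k + 1 : ℕ) - B * (max 0 (r + s - δ * r + (k + 1 : ℕ) * δ ^ 2 / 2 - c) ^ 2 +
          (k + 1 : ℕ) * δ ^ 3 / 3) ≤ value d (k + 1) (r, s) := by
      intro r hr s hs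
      have hs1 : s ∈ Icc (0 : ℝ) 1 := ⟨hs.1, hs.2.trans (by linarith)⟩
      obtain ⟨z, hz⟩ : ∃ z, z = r + s - δ * r + k * δ ^ 2 / 2 - c := ⟨_, rfl⟩
      obtain ⟨g, hg⟩ : ∃ g, g = δ * k - B * (max 0 z ^ 2 + k * δ ^ 3 / 3) := ⟨_, rfl⟩
      let ψ : ℝ → ℝ := fun y => 1 - B * (2 * max 0 z * y + y ^ 2)
      have hψ : Continuous ψ := by fun_prop
      have hsub : Ioc s (s + δ) ⊆ Icc 0 1 := fun u hu =>
        ⟨hs.1.trans hu.1.le, hu.2.trans (by linarith [hs.2])⟩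
      have hI : Integrable ((Ioc s (s + δ)).indicator fun u => ψ (u - s)) unif := by
        rw [integrable_indicator_iff measurableSet_Ioc]
        refine IntegrableOn.mono_measure ?_ Measure.restrict_le_self
        exact ((by fun_prop : Continuous fun u => ψ (u - s)).integrableOn_Icc).mono_set
          Ioc_subset_Icc_self
      have hint : ∫ u, (Ioc s (s + δ)).indicator (fun u => ψ (u - s)) u ∂unif =
          δ - B * (max 0 z * δ ^ 2 + δ ^ 3 / 3) := by
        rw [integral_indicator measurableSet_Ioc, unif, Measure.restrict_restrict measurableSet_Ioc,
          inter_eq_left.mpr hsub, ← intervalIntegral.integral_of_le (by linarith),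
          intervalIntegral.integral_comp_sub_right ψ s, sub_self, add_sub_cancel_left]
        have e : ∀ y, ψ y = 1 - B * (2 * max 0 z) * y - B * y ^ 2 := fun y => by
          simp only [ψ]; ring
        simp_rw [e]
        rw [intervalIntegral.integral_sub, intervalIntegral.integral_sub,
          intervalIntegral.integral_const_mul, intervalIntegral.integral_const_mul]
        · simp only [integral_id, integral_pow, intervalIntegral.integral_const, smul_eq_mul]
          push_cast
          ring
        all_goals exact (by fun_prop : Continuous _).intervalIntegrable _ _
      have hstep : g + (δ - B * (max 0 z * δ ^ 2 + δ ^ 3 / 3)) ≤ value d (k + 1) (r, s) := by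
        rw [value_succ k (by exact hr), ← hint]
        have : g + ∫ u, (Ioc s (s + δ)).indicator (fun u => ψ (u - s)) u ∂unif =
            ∫ u, (g + (Ioc s (s + δ)).indicator (fun u => ψ (u - s)) u) ∂unif := by
          rw [integral_add (integrable_const g) hI]; simp
        rw [this]
        refine integral_mono ((integrable_const g).add hI) (integrable_bellman d k _) fun u => ?_
        change g + (Ioc s (s + δ)).indicator (fun u => ψ (u - s)) u ≤ _
        by_cases hu : u ∈ Ioc s (s + δ)
        · rw [indicator_of_mem hu, move_of_le hu.1.le]
          refine le_max_of_le_right ?_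
          have h1 := ih r hr u (hsub hu)
          have h2 : max 0 (r + u - δ * r + k * δ ^ 2 / 2 - c) ^ 2 ≤
              max 0 z ^ 2 + (2 * max 0 z * (u - s) + (u - s) ^ 2) := by
            have h3 : max 0 (r + u - δ * r + k * δ ^ 2 / 2 - c) ≤ max 0 z + (u - s) := by
              refine max_le (add_nonneg (le_max_left _ _) (by linarith [hu.1])) ?_
              linarith [le_max_right 0 z]
            nlinarith [pow_le_pow_left₀ (le_max_left _ _) h3 2]
          have h4 := mul_le_mul_of_nonneg_left h2 hB0
          simp only [ψ]
          rw [hg]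
          linarith
        · rw [indicator_of_notMem hu, add_zero]
          exact le_max_of_le_left (hg ▸ hz ▸ ih r hr s hs1)
      refine le_trans ?_ hstep
      have hconv : max 0 z ^ 2 + max 0 z * δ ^ 2 ≤
          max 0 (r + s - δ * r + (k + 1 : ℕ) * δ ^ 2 / 2 - c) ^ 2 := by
        have e : r + s - δ * r + (k + 1 : ℕ) * δ ^ 2 / 2 - c = z + δ ^ 2 / 2 := by
          rw [hz]; push_cast; ring
        rw [e]
        rcases le_total z 0 with h | h
        · rw [max_eq_left h]; simp
        · rw [max_eq_right h, max_eq_right (by positivity)]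
          nlinarith [sq_nonneg (δ ^ 2)]
      have := mul_le_mul_of_nonneg_left hconv hB0
      rw [hg]
      push_cast at *
      linarith
    intro r hr s hs
    rcases le_or_gt s (1 - δ) with h | h
    · exact main r hr s ⟨hs.1, h⟩
    rcases hr.lt_or_eq with hrd | rfl
    ·
      calc _ ≤ δ * (k + 1 : ℕ) - B * (max 0 ((r + 1 : ℕ) + 0 - δ * (r + 1 : ℕ) +
            (k + 1 : ℕ) * δ ^ 2 / 2 - c) ^ 2 + (k + 1 : ℕ) * δ ^ 3 / 3) := by
            gcongr _ - B * (max 0 ?_ ^ 2 + _)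
            push_cast
            linarith
        _ ≤ value d (k + 1) (r + 1, 0) := main (r + 1) hrd 0 ⟨le_rfl, by linarith⟩
        _ = value d (k + 1) (r, 1) := (value_one_eq _ hrd).symm
        _ ≤ _ := value_antitone d _ _ _ _ hs.1 hs.2 le_rfl
    · -- near the end of the last block, the penalty dominates
      refine le_trans ?_ (value_nonneg _ (by exact hr))
      have hz : η ≤ max 0 (r + s - δ * r + (k + 1 : ℕ) * δ ^ 2 / 2 - c) := by
        refine le_max_of_le_right ?_
        have : 0 ≤ ((k + 1 : ℕ) : ℝ) * δ ^ 2 / 2 := by positivity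
        nlinarith
      have h1 : δ * (k + 1 : ℕ) ≤ δ * n := by gcongr
      have h2 := mul_le_mul_of_nonneg_left (pow_le_pow_left₀ hη.le hz 2) hB0
      have h3 : 0 ≤ B * (((k + 1 : ℕ) : ℝ) * δ ^ 3 / 3) := by positivity
      linarith

lemma value_le_sqrt (d : ℕ) {n : ℕ} (hn : 0 < n) :
    value d n (0, 0) ≤ √(2 * ((d : ℝ) + 1)) * √n := by
  have hn' : (0 : ℝ) < n := by exact_mod_cast hn
  obtain ⟨a, ha⟩ : ∃ a, a = √(2 * ((d : ℝ) + 1)) := ⟨_, rfl⟩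
  have ha0 : 0 < a := by rw [ha]; positivity
  have ha2 : a ^ 2 = 2 * ((d : ℝ) + 1) := by rw [ha]; exact Real.sq_sqrt (by positivity)
  have hq0 : 0 < √(n : ℝ) := by positivity
  have hq2 : √(n : ℝ) ^ 2 = n := Real.sq_sqrt hn'.le
  have h := value_le_linear d (l := √n / a) (by positivity) n 0 (Nat.zero_le d) 0
    ⟨le_rfl, zero_le_one⟩
  rw [← ha]
  refine h.trans_eq ?_
  have hd : (d : ℝ) + 1 = a ^ 2 / 2 := by linarith
  rw [hd]
  nth_rw 2 [← hq2]
  field_simp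
  push_cast
  ring

/-- The value of the selection problem is asymptotically `√(2 (d + 1) n)`. -/
lemma tendsto_value_div_sqrt (d : ℕ) :
    Tendsto (fun n : ℕ => value d n (0, 0) / √(n : ℝ)) atTop (𝓝 √(2 * ((d : ℝ) + 1))) := by
  have hsq : Tendsto (fun n : ℕ => √(n : ℝ)) atTop atTop :=
    Real.tendsto_sqrt_atTop.comp tendsto_natCast_atTop_atTop
  refine tendsto_order.mpr ⟨fun a' ha' => ?_, fun b hb => ?_⟩
  · obtain ⟨a, haa, ha⟩ := exists_between (max_lt ha' (show 0 < √(2 * ((d : ℝ) + 1)) by positivity))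
    have ha0 : 0 < a := (le_max_right _ _).trans_lt haa
    have ha'a : a' < a := (le_max_left _ _).trans_lt haa
    have hac : a ^ 2 / 2 < d + 1 := by
      have := (Real.lt_sqrt ha0.le).mp ha
      linarith
    obtain ⟨η, hη⟩ : ∃ η, η = ((d : ℝ) + 1 - a ^ 2 / 2) / 2 := ⟨_, rfl⟩
    have hη0 : 0 < η := by rw [hη]; linarith
    have hlim : Tendsto (fun n : ℕ => a - a ^ 4 / (3 * η ^ 2) / √(n : ℝ)) atTop (𝓝 (a - 0)) :=
      tendsto_const_nhds.sub (hsq.const_div_atTop _)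
    have hδ : Tendsto (fun n : ℕ => a / √(n : ℝ)) atTop (𝓝 0) := hsq.const_div_atTop _
    have hsmall := (tendsto_order.mp hδ).2 (min 1 (η / (d + 1))) (by positivity)
    filter_upwards [(tendsto_order.mp hlim).1 a' (by simpa using ha'a), hsmall,
      eventually_gt_atTop 0] with n h1 h2 hn
    refine h1.trans_le ?_
    have hn' : (0 : ℝ) < n := by exact_mod_cast hn
    have hq0 : 0 < √(n : ℝ) := by positivity
    have hq2 : √(n : ℝ) ^ 2 = n := Real.sq_sqrt hn'.le
    have hδη : a / √(n : ℝ) * (d + 1) ≤ η := by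
      rw [← le_div_iff₀ (by positivity)]
      exact (h2.trans_le (min_le_right _ _)).le
    have h := subsolution_le_value d (δ := a / √(n : ℝ)) (η := η) (c := a ^ 2 / 2)
      (B := a / √(n : ℝ) * n / η ^ 2) n (by positivity) (h2.trans_le (min_le_left _ _)).le hη0
      (by nlinarith) (by rw [div_mul_cancel₀ _ (by positivity)]) (by positivity) n le_rfl 0
      (Nat.zero_le d) 0 ⟨le_rfl, zero_le_one⟩
    have hz : ((0 : ℕ) : ℝ) + 0 - a / √(n : ℝ) * (0 : ℕ) + n * (a / √(n : ℝ)) ^ 2 / 2 - a ^ 2 / 2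
        = 0 := by
      rw [div_pow, hq2]
      field_simp
      push_cast
      ring
    rw [hz] at h
    rw [le_div_iff₀ hq0]
    refine le_trans (le_of_eq ?_) h
    obtain ⟨q, hq⟩ : ∃ q, q = √(n : ℝ) := ⟨_, rfl⟩
    rw [← hq] at hq0 hq2 ⊢
    rw [← hq2, max_self]
    field_simp
    ring
  · filter_upwards [eventually_gt_atTop 0] with n hn
    have hn' : (0 : ℝ) < n := by exact_mod_cast hn
    refine lt_of_le_of_lt ?_ hb
    rw [div_le_iff₀ (by positivity)]
    exact value_le_sqrt d hn

/-! ### Selection processes driven by uniform observations -/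

/-- The reading of the value `u` in block number `r`: upside down in the decreasing blocks. -/
noncomputable def orient (r : ℕ) (u : ℝ) : ℝ := if Even r then u else 1 - u

/-- The state reached from `z` by selecting the observation `u`. -/
noncomputable def step (z : ℕ × ℝ) (u : ℝ) : ℕ × ℝ := move z (orient z.1 u)

lemma measurable_orient : Measurable fun p : ℕ × ℝ => orient p.1 p.2 :=
  Measurable.ite (measurable_fst (MeasurableSet.of_discrete (s := {r : ℕ | Even r})))
    (by fun_prop) (by fun_prop)

lemma measurable_step : Measurable fun p : (ℕ × ℝ) × ℝ => step p.1 p.2 :=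
  measurable_move.comp (measurable_fst.prodMk
    (measurable_orient.comp ((measurable_fst.comp measurable_fst).prodMk measurable_snd)))

lemma measurePreserving_orient (r : ℕ) : MeasurePreserving (orient r) unif unif := by
  by_cases h : Even r
  · have : orient r = id := by ext u; simp [orient, h]
    rw [this]; exact MeasurePreserving.id _
  · have : orient r = fun u => 1 - u := by ext u; simp [orient, h]
    rw [this]; exact measurePreserving_one_sub

lemma orient_mem {r : ℕ} {u : ℝ} (hu : u ∈ Icc (0 : ℝ) 1) : orient r u ∈ Icc (0 : ℝ) 1 := by
  unfold orient
  split_ifs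
  · exact hu
  · exact ⟨by linarith [hu.2], by linarith [hu.1]⟩

lemma step_of_le {z : ℕ × ℝ} {u : ℝ} (h : z.2 ≤ orient z.1 u) : step z u = (z.1, orient z.1 u) :=
  if_pos h

lemma step_of_lt {z : ℕ × ℝ} {u : ℝ} (h : orient z.1 u < z.2) :
    step z u = (z.1 + 1, orient (z.1 + 1) u) := by
  have : step z u = (z.1 + 1, 1 - orient z.1 u) := if_neg h.not_ge
  rw [this]
  unfold orient
  by_cases he : Even z.1 <;> simp [he, Nat.even_add_one]

/-- After a selection, the last value is the selected one, read in the current block. -/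
lemma step_snd (z : ℕ × ℝ) (u : ℝ) : (step z u).2 = orient (step z u).1 u := by
  rcases le_or_gt z.2 (orient z.1 u) with h | h
  · rw [step_of_le h]
  · rw [step_of_lt h]

lemma step_snd_mem {z : ℕ × ℝ} {u : ℝ} (hu : u ∈ Icc (0 : ℝ) 1) :
    (step z u).2 ∈ Icc (0 : ℝ) 1 := by
  rw [step_snd]; exact orient_mem hu

lemma measurable_value_step (d k : ℕ) :
    Measurable fun p : (ℕ × ℝ) × ℝ => value d k (step p.1 p.2) :=
  (measurable_value d k).comp measurable_step

/-- The better of rejecting and of selecting the observation `u` in the state `z`, when `k` further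
observations are to come. -/
noncomputable def best (d k : ℕ) (z : ℕ × ℝ) (u : ℝ) : ℝ :=
  max (value d k z) (1 + value d k (step z u))

lemma measurable_best (d k : ℕ) : Measurable fun p : (ℕ × ℝ) × ℝ => best d k p.1 p.2 :=
  ((measurable_value d k).comp measurable_fst).max ((measurable_value_step d k).const_add 1)

lemma abs_best_le (d k : ℕ) (z : ℕ × ℝ) (u : ℝ) : |best d k z u| ≤ k + 3 :=
  abs_bellman_le d k _ _

lemma integrable_best (d k : ℕ) (z : ℕ × ℝ) : Integrable (best d k z) unif :=
  integrable_unif ((measurable_best d k).comp (measurable_const.prodMk measurable_id))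
    fun _ => abs_best_le d k _ _

lemma integral_best {d : ℕ} (k : ℕ) {z : ℕ × ℝ} (hz : z.1 ≤ d) :
    ∫ u, best d k z u ∂unif = value d (k + 1) z := by
  have h := (measurePreserving_orient z.1)
  rw [value_succ k hz]
  conv_rhs => rw [← h.map_eq]
  rw [integral_map h.measurable.aemeasurable (measurable_bellman d k z).aestronglyMeasurable]
  rfl

lemma ae_value_step_ne (d k : ℕ) {z : ℕ × ℝ} (hz : z.1 ≤ d) :
    ∀ᵐ u ∂unif, 1 + value d k (step z u) ≠ value d k z :=
  (measurePreserving_orient z.1).quasiMeasurePreserving.ae (ae_value_ne d k hz)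

variable {Ω : Type*}

open Classical in
/-- The state before time `i` when the observations are selected according to the events `A`. -/
noncomputable def state (U : ℕ → Ω → ℝ) (A : ℕ → Set Ω) : ℕ → Ω → ℕ × ℝ
  | 0, _ => (0, 0)
  | i + 1, ω => if ω ∈ A i then step (state U A i ω) (U i ω) else state U A i ω

/-- The number of selections before time `i`. -/
noncomputable def count (A : ℕ → Set Ω) (i : ℕ) (ω : Ω) : ℝ :=
  ∑ l ∈ Finset.range i, (A l).indicator 1 ω

lemma state_succ_of_mem {U : ℕ → Ω → ℝ} {A : ℕ → Set Ω} {i : ℕ} {ω : Ω} (h : ω ∈ A i) :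
    state U A (i + 1) ω = step (state U A i ω) (U i ω) := if_pos h

lemma state_succ_of_notMem {U : ℕ → Ω → ℝ} {A : ℕ → Set Ω} {i : ℕ} {ω : Ω} (h : ω ∉ A i) :
    state U A (i + 1) ω = state U A i ω := if_neg h

lemma abs_count_le (A : ℕ → Set Ω) (i : ℕ) (ω : Ω) : |count A i ω| ≤ i := by
  have h0 : ∀ l, 0 ≤ (A l).indicator (1 : Ω → ℝ) ω := fun l =>
    indicator_nonneg (fun _ _ => zero_le_one) _
  rw [abs_of_nonneg (show 0 ≤ count A i ω from Finset.sum_nonneg fun l _ => h0 l)]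
  calc count A i ω ≤ ∑ _l ∈ Finset.range i, (1 : ℝ) := Finset.sum_le_sum fun l _ =>
        indicator_le' (fun _ _ => le_rfl) (fun _ _ => zero_le_one) _
    _ = i := by simp

variable [mΩ : MeasurableSpace Ω]

/-- The observations `U 0, …, U (n - 1)` are uniform, each of them is independent of the history
`G i` before its time `i`, and it belongs to the history afterwards. -/
structure IsUniformStream (P : Measure Ω) (n : ℕ) (G : ℕ → MeasurableSpace Ω) (U : ℕ → Ω → ℝ) :
    Prop where
  mono : Monotone G
  le : ∀ i, G i ≤ mΩ
  measurable : ∀ i, Measurable[G (i + 1)] (U i)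
  mem : ∀ i ω, U i ω ∈ Icc (0 : ℝ) 1
  law : ∀ i < n, P.map (U i) = unif
  indep : ∀ i < n, Indep (G i) (MeasurableSpace.comap (U i) inferInstance) P

namespace IsUniformStream

variable {P : Measure Ω} {n : ℕ} {G : ℕ → MeasurableSpace Ω}
  {U : ℕ → Ω → ℝ}

lemma measurable_state (hU : IsUniformStream P n G U) {A : ℕ → Set Ω}
    (hA : ∀ i, MeasurableSet[G (i + 1)] (A i)) (i : ℕ) : Measurable[G i] (state U A i) := by
  induction i with
  | zero => exact @measurable_const _ _ _ (G 0) _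
  | succ i ih =>
    have h1 : Measurable[G (i + 1)] (state U A i) := ih.mono (hU.mono i.le_succ) le_rfl
    exact Measurable.ite (hA i) (measurable_step.comp (h1.prodMk (hU.measurable i))) h1

lemma measurable_count (hU : IsUniformStream P n G U) {A : ℕ → Set Ω}
    (hA : ∀ i, MeasurableSet[G (i + 1)] (A i)) (i : ℕ) : Measurable[G i] (count A i) := by
  refine Finset.measurable_fun_sum _ fun l hl => ?_
  have h1 : Measurable[G i] (1 : Ω → ℝ) := @measurable_const _ _ _ (G i) 1
  have hs : MeasurableSet[G i] (A l) :=
    (hU.mono (Finset.mem_range.mp hl) : G (l + 1) ≤ G i) _ (hA l)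
  exact h1.indicator hs

lemma state_snd_mem (hU : IsUniformStream P n G U) (A : ℕ → Set Ω) (i : ℕ) (ω : Ω) :
    (state U A i ω).2 ∈ Icc (0 : ℝ) 1 := by
  induction i with
  | zero => exact ⟨le_rfl, zero_le_one⟩
  | succ i ih =>
    by_cases h : ω ∈ A i
    · rw [state_succ_of_mem h]; exact step_snd_mem (hU.mem i ω)
    · rwa [state_succ_of_notMem h]

variable [IsProbabilityMeasure P]

lemma map_pair {β : Type*} [MeasurableSpace β] (hU : IsUniformStream P n G U) {i : ℕ} (hi : i < n)
    {Y : Ω → β} (hY : Measurable[G i] Y) :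
    P.map (fun ω => (Y ω, U i ω)) = (P.map Y).prod unif := by
  have hY' : Measurable Y := hY.mono (hU.le i) le_rfl
  have hUi : Measurable (U i) := (hU.measurable i).mono (hU.le _) le_rfl
  have hind : IndepFun Y (U i) P :=
    (IndepFun_iff_Indep _ _ _).mpr (indep_of_indep_of_le_left (hU.indep i hi) hY.comap_le)
  rw [(indepFun_iff_map_prod_eq_prod_map_map hY'.aemeasurable hUi.aemeasurable).mp hind,
    hU.law i hi]

/-- Conditioning on the history. -/
lemma integral_pair {β : Type*} [MeasurableSpace β] (hU : IsUniformStream P n G U) {i : ℕ}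
    (hi : i < n) {Y : Ω → β} (hY : Measurable[G i] Y) {φ : β → ℝ → ℝ}
    (hφ : Measurable (Function.uncurry φ)) {C : ℝ} (hC : ∀ y u, |φ y u| ≤ C) :
    ∫ ω, φ (Y ω) (U i ω) ∂P = ∫ ω, ∫ u, φ (Y ω) u ∂unif ∂P := by
  have hY' : Measurable Y := hY.mono (hU.le i) le_rfl
  have hUi : Measurable (U i) := (hU.measurable i).mono (hU.le _) le_rfl
  have : IsProbabilityMeasure (P.map Y) := Measure.isProbabilityMeasure_map hY'.aemeasurable
  have h1 : ∫ ω, φ (Y ω) (U i ω) ∂P =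
      ∫ p, Function.uncurry φ p ∂(P.map fun ω => (Y ω, U i ω)) :=
    (integral_map (hY'.prodMk hUi).aemeasurable hφ.aestronglyMeasurable).symm
  rw [h1, hU.map_pair hi hY, integral_prod _ (Integrable.of_bound hφ.aestronglyMeasurable C
    (Eventually.of_forall fun p => hC p.1 p.2)), integral_map hY'.aemeasurable
    (StronglyMeasurable.integral_prod_right (f := fun y u => Function.uncurry φ (y, u))
      hφ.stronglyMeasurable).aestronglyMeasurable]
  rfl

lemma ae_pair {β : Type*} [MeasurableSpace β] (hU : IsUniformStream P n G U) {i : ℕ}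
    (hi : i < n) {Y : Ω → β} (hY : Measurable[G i] Y) {S : Set (β × ℝ)} (hS : MeasurableSet S)
    (h : ∀ ω, ∀ᵐ u ∂unif, (Y ω, u) ∈ S) : ∀ᵐ ω ∂P, (Y ω, U i ω) ∈ S := by
  have hY' : Measurable Y := hY.mono (hU.le i) le_rfl
  have hUi : Measurable (U i) := (hU.measurable i).mono (hU.le _) le_rfl
  have hmap : ∀ᵐ p ∂(P.map fun ω => (Y ω, U i ω)), p ∈ S := by
    rw [hU.map_pair hi hY]
    refine (Measure.measure_prod_null hS.compl).mpr ?_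
    refine (ae_map_iff hY'.aemeasurable ?_).mpr (Eventually.of_forall h)
    exact (measurable_measure_prodMk_left hS.compl) (measurableSet_singleton 0)
  exact ae_of_ae_map (hY'.prodMk hUi).aemeasurable hmap

end IsUniformStream

/-! ### Mean and variance of the number of selections -/

open Classical in
/-- The value of the decision taken at time `i`: rejection or selection of `U i`. -/
noncomputable def taken (d n : ℕ) {Ω : Type*} (U : ℕ → Ω → ℝ) (A : ℕ → Set Ω) (i : ℕ) (ω : Ω) :
    ℝ :=
  if ω ∈ A i then 1 + value d (n - (i + 1)) (step (state U A i ω) (U i ω))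
  else value d (n - (i + 1)) (state U A i ω)

/-- The value of the better decision at time `i`. -/
noncomputable def bestAt (d n : ℕ) {Ω : Type*} (U : ℕ → Ω → ℝ) (A : ℕ → Set Ω) (i : ℕ) (ω : Ω) :
    ℝ :=
  best d (n - (i + 1)) (state U A i ω) (U i ω)

/-- The selections made so far together with the expected further ones: a supermartingale, and a
martingale if all decisions are optimal. -/
noncomputable def potential (d n : ℕ) {Ω : Type*} (U : ℕ → Ω → ℝ) (A : ℕ → Set Ω) (i : ℕ)
    (ω : Ω) : ℝ :=
  count A i ω + value d (n - i) (state U A i ω)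

section

variable {Ω : Type*} {d n : ℕ} {U : ℕ → Ω → ℝ} {A : ℕ → Set Ω}

lemma taken_le_bestAt (i : ℕ) (ω : Ω) : taken d n U A i ω ≤ bestAt d n U A i ω := by
  unfold taken bestAt best
  split_ifs
  · exact le_max_right _ _
  · exact le_max_left _ _

lemma potential_succ (i : ℕ) (ω : Ω) :
    potential d n U A (i + 1) ω = count A i ω + taken d n U A i ω := by
  unfold potential taken count
  rw [Finset.sum_range_succ]
  by_cases h : ω ∈ A i
  · rw [state_succ_of_mem h, indicator_of_mem h, if_pos h, Pi.one_apply]; ring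
  · rw [state_succ_of_notMem h, indicator_of_notMem h, if_neg h]; ring

lemma potential_zero (ω : Ω) : potential d n U A 0 ω = value d n (0, 0) := by
  simp [potential, count, state]

lemma potential_end {ω : Ω} (h : (state U A n ω).1 ≤ d) :
    potential d n U A n ω = count A n ω := by
  rw [potential, Nat.sub_self, value_zero h, add_zero]

end

namespace IsUniformStream

variable {Ω : Type*} [mΩ : MeasurableSpace Ω] {P : Measure Ω}
  {d n : ℕ} {G : ℕ → MeasurableSpace Ω} {U : ℕ → Ω → ℝ} {A : ℕ → Set Ω}

lemma measurable_state_top (hU : IsUniformStream P n G U)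
    (hA : ∀ i, MeasurableSet[G (i + 1)] (A i)) (i : ℕ) : Measurable (state U A i) :=
  (hU.measurable_state hA i).mono (hU.le i) le_rfl

lemma measurable_top (hU : IsUniformStream P n G U) (i : ℕ) : Measurable (U i) :=
  (hU.measurable i).mono (hU.le _) le_rfl

lemma measurableSet_top (hU : IsUniformStream P n G U)
    (hA : ∀ i, MeasurableSet[G (i + 1)] (A i)) (i : ℕ) : MeasurableSet (A i) :=
  hU.le _ _ (hA i)

lemma measurable_bestAt (hU : IsUniformStream P n G U)
    (hA : ∀ i, MeasurableSet[G (i + 1)] (A i)) (i : ℕ) : Measurable (bestAt d n U A i) :=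
  (measurable_best d _).comp ((hU.measurable_state_top hA i).prodMk (hU.measurable_top i))

variable [IsProbabilityMeasure P]

lemma integrable_count (hU : IsUniformStream P n G U)
    (hA : ∀ i, MeasurableSet[G (i + 1)] (A i)) (i : ℕ) : Integrable (count A i) P :=
  Integrable.of_bound ((hU.measurable_count hA i).mono (hU.le i) le_rfl).aestronglyMeasurable i
    (Eventually.of_forall fun ω => abs_count_le A i ω)

lemma integrable_value_state (hU : IsUniformStream P n G U)
    (hA : ∀ i, MeasurableSet[G (i + 1)] (A i)) (k i : ℕ) :
    Integrable (fun ω => value d k (state U A i ω)) P :=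
  Integrable.of_bound
    ((measurable_value d k).comp (hU.measurable_state_top hA i)).aestronglyMeasurable (k + 2)
    (Eventually.of_forall fun _ => abs_value_le d k _)

lemma integrable_bestAt (hU : IsUniformStream P n G U)
    (hA : ∀ i, MeasurableSet[G (i + 1)] (A i)) (i : ℕ) : Integrable (bestAt d n U A i) P :=
  Integrable.of_bound (hU.measurable_bestAt hA i).aestronglyMeasurable
    (((n - (i + 1) : ℕ) : ℝ) + 3) (Eventually.of_forall fun _ => abs_best_le d _ _ _)

lemma integrable_potential (hU : IsUniformStream P n G U)
    (hA : ∀ i, MeasurableSet[G (i + 1)] (A i)) (i : ℕ) : Integrable (potential d n U A i) P :=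
  (hU.integrable_count hA i).add (hU.integrable_value_state hA _ i)

lemma integrable_taken (hU : IsUniformStream P n G U)
    (hA : ∀ i, MeasurableSet[G (i + 1)] (A i)) (i : ℕ) : Integrable (taken d n U A i) P := by
  have : taken d n U A i = fun ω => potential d n U A (i + 1) ω - count A i ω := by
    ext ω; rw [potential_succ]; ring
  rw [this]
  exact (hU.integrable_potential hA _).sub (hU.integrable_count hA i)

lemma integral_bestAt (hU : IsUniformStream P n G U)
    (hA : ∀ i, MeasurableSet[G (i + 1)] (A i)) (hd : ∀ i ω, (state U A i ω).1 ≤ d) {i : ℕ}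
    (hi : i < n) :
    ∫ ω, bestAt d n U A i ω ∂P = ∫ ω, value d (n - i) (state U A i ω) ∂P := by
  have h := hU.integral_pair hi (hU.measurable_state hA i)
    (φ := best d (n - (i + 1))) (measurable_best d _) (abs_best_le d _)
  refine h.trans (integral_congr_ae (Eventually.of_forall fun ω => ?_))
  simp only
  rw [integral_best _ (hd i ω), show n - (i + 1) + 1 = n - i by omega]

/-- The expected number of selections falls short of the Bellman value by the expected losses of
the single decisions. -/
lemma integral_count (hU : IsUniformStream P n G U)
    (hA : ∀ i, MeasurableSet[G (i + 1)] (A i)) (hd : ∀ i ω, (state U A i ω).1 ≤ d) :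
    ∫ ω, count A n ω ∂P = value d n (0, 0) -
      ∑ i ∈ Finset.range n, ∫ ω, (bestAt d n U A i ω - taken d n U A i ω) ∂P := by
  have key : ∀ m ≤ n, ∫ ω, potential d n U A m ω ∂P = value d n (0, 0) -
      ∑ i ∈ Finset.range m, ∫ ω, (bestAt d n U A i ω - taken d n U A i ω) ∂P := by
    intro m hm
    induction m with
    | zero => simp [potential_zero]
    | succ m ih =>
      have h1 : ∫ ω, potential d n U A m ω ∂P =
          ∫ ω, count A m ω ∂P + ∫ ω, bestAt d n U A m ω ∂P := by
        rw [hU.integral_bestAt hA hd (by omega)]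
        exact integral_add (hU.integrable_count hA m) (hU.integrable_value_state hA _ m)
      have h2 : ∫ ω, potential d n U A (m + 1) ω ∂P =
          ∫ ω, count A m ω ∂P + ∫ ω, taken d n U A m ω ∂P := by
        simp_rw [potential_succ]
        exact integral_add (hU.integrable_count hA m) (hU.integrable_taken hA m)
      rw [Finset.sum_range_succ, integral_sub (hU.integrable_bestAt hA m)
        (hU.integrable_taken hA m)]
      linarith [ih (by omega)]
  rw [← key n le_rfl]
  exact integral_congr_ae (Eventually.of_forall fun ω => (potential_end (hd n ω)).symm)

lemma integral_count_le (hU : IsUniformStream P n G U)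
    (hA : ∀ i, MeasurableSet[G (i + 1)] (A i)) (hd : ∀ i ω, (state U A i ω).1 ≤ d) :
    ∫ ω, count A n ω ∂P ≤ value d n (0, 0) := by
  rw [hU.integral_count hA hd]
  exact sub_le_self _ (Finset.sum_nonneg fun i _ =>
    integral_nonneg fun ω => sub_nonneg.mpr (taken_le_bestAt i ω))

lemma integral_count_eq_iff (hU : IsUniformStream P n G U)
    (hA : ∀ i, MeasurableSet[G (i + 1)] (A i)) (hd : ∀ i ω, (state U A i ω).1 ≤ d) :
    ∫ ω, count A n ω ∂P = value d n (0, 0) ↔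
      ∀ i < n, ∀ᵐ ω ∂P, taken d n U A i ω = bestAt d n U A i ω := by
  have h0 : ∀ i, 0 ≤ fun ω => bestAt d n U A i ω - taken d n U A i ω := fun i ω =>
    sub_nonneg.mpr (taken_le_bestAt i ω)
  rw [hU.integral_count hA hd, sub_eq_self,
    Finset.sum_eq_zero_iff_of_nonneg fun i _ => integral_nonneg (h0 i)]
  simp only [Finset.mem_range]
  refine forall₂_congr fun i _ => ?_
  rw [integral_eq_zero_iff_of_nonneg (h0 i)
    ((hU.integrable_bestAt hA i).sub (hU.integrable_taken hA i))]
  refine ⟨fun h => ?_, fun h => ?_⟩ <;> filter_upwards [h] with ω hω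
  · simp only [Pi.zero_apply] at hω; linarith
  · simp [hω]

/-- Optimal decisions are almost surely determined by the state and the observation. -/
lemma ae_mem_iff (hU : IsUniformStream P n G U)
    (hA : ∀ i, MeasurableSet[G (i + 1)] (A i)) (hd : ∀ i ω, (state U A i ω).1 ≤ d) {i : ℕ}
    (hi : i < n) (hopt : ∀ᵐ ω ∂P, taken d n U A i ω = bestAt d n U A i ω) :
    ∀ᵐ ω ∂P, ω ∈ A i ↔ value d (n - (i + 1)) (state U A i ω) <
      1 + value d (n - (i + 1)) (step (state U A i ω) (U i ω)) := by
  have hS : MeasurableSet {p : (ℕ × ℝ) × ℝ |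
      1 + value d (n - (i + 1)) (step p.1 p.2) ≠ value d (n - (i + 1)) p.1} :=
    (measurableSet_eq_fun ((measurable_value_step d _).const_add 1)
      ((measurable_value d _).comp measurable_fst)).compl
  have hne := hU.ae_pair hi (hU.measurable_state hA i) hS
    fun ω => ae_value_step_ne d (n - (i + 1)) (hd i ω)
  filter_upwards [hopt, hne] with ω h1 h2
  replace h2 : 1 + value d (n - (i + 1)) (step (state U A i ω) (U i ω)) ≠
      value d (n - (i + 1)) (state U A i ω) := h2
  unfold taken bestAt best at h1
  split_ifs at h1 with h
  · simp only [h, true_iff]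
    exact lt_of_le_of_ne (h1 ▸ le_max_left _ _) h2.symm
  · simp only [h, false_iff, not_lt]
    exact h1 ▸ le_max_right _ _

/-- One step of the second moment of the potential under optimal decisions. The increment of the
potential has conditional mean zero, and up to a conditionally constant term it lies between `0`
and the indicator of a selection. -/
lemma integral_potential_sq_succ_le (hU : IsUniformStream P n G U)
    (hA : ∀ i, MeasurableSet[G (i + 1)] (A i)) (hd : ∀ i ω, (state U A i ω).1 ≤ d) {i : ℕ}
    (hi : i < n) (hopt : ∀ᵐ ω ∂P, taken d n U A i ω = bestAt d n U A i ω) :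
    ∫ ω, potential d n U A (i + 1) ω ^ 2 ∂P ≤
      ∫ ω, potential d n U A i ω ^ 2 ∂P + ∫ ω, (A i).indicator 1 ω ∂P := by
  obtain ⟨k, hk⟩ : ∃ k, k = n - (i + 1) := ⟨_, rfl⟩
  have hk1 : n - i = k + 1 := by omega
  have hY : Measurable[G i] fun ω => (count A i ω, state U A i ω) :=
    (hU.measurable_count hA i).prodMk (hU.measurable_state hA i)
  -- truncation of the count makes the integrand bounded
  let c : ℝ → ℝ := fun m => max (-n) (min n m)
  have hc : ∀ m, |c m| ≤ n := fun m => abs_le.mpr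
    ⟨le_max_left _ _, max_le (by linarith [(Nat.cast_nonneg n : (0 : ℝ) ≤ n)]) (min_le_left _ _)⟩
  have hcc : ∀ ω, c (count A i ω) = count A i ω := by
    intro ω
    have h := abs_le.mp ((abs_count_le A i ω).trans (Nat.cast_le.mpr hi.le : (i : ℝ) ≤ n))
    simp only [c]
    rw [min_eq_right h.2, max_eq_right h.1]
  have hbest : Measurable fun p : (ℝ × (ℕ × ℝ)) × ℝ => best d k p.1.2 p.2 :=
    (measurable_best d k).comp ((measurable_snd.comp measurable_fst).prodMk measurable_snd)
  have hvalue : Measurable fun p : (ℝ × (ℕ × ℝ)) × ℝ => value d k p.1.2 :=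
    (measurable_value d k).comp (measurable_snd.comp measurable_fst)
  have hcm : Measurable fun p : (ℝ × (ℕ × ℝ)) × ℝ => c p.1.1 := by
    simp only [c]; fun_prop
  let φ : ℝ × (ℕ × ℝ) → ℝ → ℝ := fun y u => (c y.1 + best d k y.2 u) ^ 2
  let χ : ℝ × (ℕ × ℝ) → ℝ → ℝ := fun y u => (best d k y.2 u - value d k y.2) ^ 2
  have hφm : Measurable (Function.uncurry φ) := (hcm.add hbest).pow_const 2
  have hχm : Measurable (Function.uncurry χ) := (hbest.sub hvalue).pow_const 2
  have hφ : ∀ y u, |φ y u| ≤ ((n : ℝ) + (k + 3)) ^ 2 := fun y u => by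
    rw [abs_pow]
    exact pow_le_pow_left₀ (abs_nonneg _)
      ((abs_add_le _ _).trans (add_le_add (hc _) (abs_best_le d k _ _))) 2
  have hχ : ∀ y u, |χ y u| ≤ ((k + 3) + ((k : ℝ) + 2)) ^ 2 := fun y u => by
    rw [abs_pow]
    exact pow_le_pow_left₀ (abs_nonneg _)
      ((abs_sub _ _).trans (add_le_add (abs_best_le d k _ _) (abs_value_le d k _))) 2
  have hφI := hU.integral_pair hi hY hφm hφ
  have hχI := hU.integral_pair hi hY hχm hχ
  -- the conditional inequality
  have hcond : ∀ m z, z.1 ≤ d → ∫ u, φ (m, z) u ∂unif ≤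
      (c m + value d (k + 1) z) ^ 2 + ∫ u, χ (m, z) u ∂unif := by
    intro m z hz
    have hb := integrable_best d k z
    have hb2 : Integrable (fun u => best d k z u ^ 2) unif :=
      integrable_unif (((measurable_best d k).comp
        (measurable_const.prodMk measurable_id)).pow_const 2) (C := ((k : ℝ) + 3) ^ 2) fun u => by
          rw [abs_pow]; exact pow_le_pow_left₀ (abs_nonneg _) (abs_best_le d k _ _) 2
    have expand : ∀ a : ℝ, ∫ u, (a + best d k z u) ^ 2 ∂unif =
        a ^ 2 + 2 * a * value d (k + 1) z + ∫ u, best d k z u ^ 2 ∂unif := by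
      intro a
      have e : ∀ u, (a + best d k z u) ^ 2 = (a ^ 2 + 2 * a * best d k z u) + best d k z u ^ 2 :=
        fun u => by ring
      simp_rw [e]
      have hab : Integrable (fun u => a ^ 2 + 2 * a * best d k z u) unif :=
        (integrable_const _).add (hb.const_mul _)
      rw [integral_add hab hb2,
        integral_add (integrable_const _) (hb.const_mul _), integral_const_mul,
        integral_best k hz]
      simp
    have h1 := expand (c m)
    have h2 := expand (-value d k z)
    have h3 : ∫ u, χ (m, z) u ∂unif = ∫ u, (-value d k z + best d k z u) ^ 2 ∂unif :=
      integral_congr_ae (Eventually.of_forall fun u => by simp only [χ]; ring)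
    rw [h3, h2]
    refine h1.trans_le ?_
    nlinarith [sq_nonneg (value d k z - value d (k + 1) z)]
  have hint : ∀ {ψ : ℝ × (ℕ × ℝ) → ℝ → ℝ} {C : ℝ}, Measurable (Function.uncurry ψ) →
      (∀ y u, |ψ y u| ≤ C) →
      Integrable (fun ω => ∫ u, ψ (count A i ω, state U A i ω) u ∂unif) P := by
    intro ψ C hm hC
    have hm' : Measurable fun y => ∫ u, ψ y u ∂unif :=
      (StronglyMeasurable.integral_prod_right (f := ψ) hm.stronglyMeasurable).measurable
    refine Integrable.of_bound
      (hm'.comp (hY.mono (hU.le i) le_rfl)).aestronglyMeasurable C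
      (Eventually.of_forall fun ω => ?_)
    refine (norm_integral_le_of_norm_le_const (Eventually.of_forall fun u => hC _ u)).trans ?_
    simp
  have hpot : Integrable (fun ω => potential d n U A i ω ^ 2) P := by
    refine Integrable.of_bound (C := ((i : ℝ) + ((n - i : ℕ) + 2)) ^ 2)
      ((((hU.measurable_count hA i).mono (hU.le i) le_rfl).add
        ((measurable_value d _).comp (hU.measurable_state_top hA i))).pow_const
          2).aestronglyMeasurable
      (Eventually.of_forall fun ω => ?_)
    rw [Real.norm_eq_abs, abs_pow]
    exact pow_le_pow_left₀ (abs_nonneg _)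
      ((abs_add_le _ _).trans (add_le_add (abs_count_le A i ω) (abs_value_le d _ _))) 2
  have hlast : ∫ ω, χ (count A i ω, state U A i ω) (U i ω) ∂P ≤ ∫ ω, (A i).indicator 1 ω ∂P := by
    refine integral_mono_ae ?_
      ((integrable_const (1 : ℝ)).indicator (hU.measurableSet_top hA i)) ?_
    · exact Integrable.of_bound (hχm.comp ((hY.mono (hU.le i) le_rfl).prodMk
        (hU.measurable_top i))).aestronglyMeasurable _ (Eventually.of_forall fun ω => hχ _ _)
    filter_upwards [hopt] with ω hω
    have hb : best d k (state U A i ω) (U i ω) = taken d n U A i ω := by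
      rw [hω, bestAt, ← hk]
    simp only [χ]
    rw [hb]
    have hge : value d k (state U A i ω) ≤ taken d n U A i ω := hb ▸ le_max_left _ _
    unfold taken at hge ⊢
    rw [← hk] at hge ⊢
    by_cases h : ω ∈ A i
    · rw [if_pos h] at hge ⊢
      rw [indicator_of_mem h, Pi.one_apply]
      have := value_move_le d k (hU.state_snd_mem A i ω)
        (orient_mem (r := (state U A i ω).1) (hU.mem i ω))
      change value d k (step (state U A i ω) (U i ω)) ≤ _ at this
      exact pow_le_one₀ (by linarith) (by linarith)
    · rw [if_neg h, indicator_of_notMem h]; simp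
  calc ∫ ω, potential d n U A (i + 1) ω ^ 2 ∂P
      = ∫ ω, φ (count A i ω, state U A i ω) (U i ω) ∂P := by
        refine integral_congr_ae ?_
        filter_upwards [hopt] with ω hω
        rw [potential_succ, hω]
        simp only [φ, bestAt, ← hk, hcc]
    _ = ∫ ω, ∫ u, φ (count A i ω, state U A i ω) u ∂unif ∂P := hφI
    _ ≤ ∫ ω, (potential d n U A i ω ^ 2 +
          ∫ u, χ (count A i ω, state U A i ω) u ∂unif) ∂P := by
        refine integral_mono (hint hφm hφ) (hpot.add (hint hχm hχ)) fun ω => ?_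
        have := hcond (count A i ω) (state U A i ω) (hd i ω)
        rwa [hcc, ← hk1] at this
    _ = ∫ ω, potential d n U A i ω ^ 2 ∂P + ∫ ω, χ (count A i ω, state U A i ω) (U i ω) ∂P := by
        rw [integral_add hpot (hint hχm hχ), hχI]
    _ ≤ _ := add_le_add le_rfl hlast

lemma variance_count_le (hU : IsUniformStream P n G U)
    (hA : ∀ i, MeasurableSet[G (i + 1)] (A i)) (hd : ∀ i ω, (state U A i ω).1 ≤ d)
    (hopt : ∀ i < n, ∀ᵐ ω ∂P, taken d n U A i ω = bestAt d n U A i ω) :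
    variance (count A n) P ≤ ∫ ω, count A n ω ∂P := by
  have key : ∀ m ≤ n, ∫ ω, potential d n U A m ω ^ 2 ∂P ≤
      value d n (0, 0) ^ 2 + ∫ ω, count A m ω ∂P := by
    intro m hm
    induction m with
    | zero => simp [potential_zero, count]
    | succ m ih =>
      have h1 := hU.integral_potential_sq_succ_le hA hd hm (hopt m hm)
      have h2 : ∫ ω, count A (m + 1) ω ∂P =
          ∫ ω, count A m ω ∂P + ∫ ω, (A m).indicator 1 ω ∂P := by
        refine Eq.trans ?_ (integral_add (hU.integrable_count hA m)
          ((integrable_const (1 : ℝ)).indicator (hU.measurableSet_top hA m)))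
        exact integral_congr_ae (Eventually.of_forall fun ω => Finset.sum_range_succ _ _)
      linarith [ih (by omega)]
  have hL : MemLp (count A n) 2 P := MemLp.of_bound
    (hU.integrable_count hA n).aestronglyMeasurable n
    (Eventually.of_forall fun ω => abs_count_le A n ω)
  rw [variance_eq_sub hL, (hU.integral_count_eq_iff hA hd).mpr hopt]
  have h1 := key n le_rfl
  simp_rw [fun ω => potential_end (hd n ω)] at h1
  rw [(hU.integral_count_eq_iff hA hd).mpr hopt] at h1
  simp only [Pi.pow_apply]
  linarith

end IsUniformStream

/-! ### The optimal selection -/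

section

variable {Ω : Type*}

open Classical in
/-- The state before time `i` when an observation is selected if this is strictly better than
rejecting it and if its value has not occurred before. -/
noncomputable def optimalState (d n : ℕ) (U : ℕ → Ω → ℝ) : ℕ → Ω → ℕ × ℝ
  | 0, _ => (0, 0)
  | i + 1, ω =>
    if (i < n ∧ ∀ j < i, U j ω ≠ U i ω) ∧ value d (n - (i + 1)) (optimalState d n U i ω) <
        1 + value d (n - (i + 1)) (step (optimalState d n U i ω) (U i ω))
    then step (optimalState d n U i ω) (U i ω) else optimalState d n U i ω

/-- The selection events of the optimal policy. Values that occur twice have to be avoided because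
distinct observations with the same uniform value could be in the wrong order. -/
def optimalSelect (d n : ℕ) (U : ℕ → Ω → ℝ) (i : ℕ) : Set Ω :=
  {ω | (i < n ∧ ∀ j < i, U j ω ≠ U i ω) ∧ value d (n - (i + 1)) (optimalState d n U i ω) <
    1 + value d (n - (i + 1)) (step (optimalState d n U i ω) (U i ω))}

lemma state_optimalSelect (d n : ℕ) (U : ℕ → Ω → ℝ) (i : ℕ) (ω : Ω) :
    state U (optimalSelect d n U) i ω = optimalState d n U i ω := by
  induction i with
  | zero => rfl
  | succ i ih =>
    by_cases h : ω ∈ optimalSelect d n U i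
    · rw [state_succ_of_mem h, ih]
      exact (if_pos h).symm
    · rw [state_succ_of_notMem h, ih]
      exact (if_neg h).symm

lemma optimalState_fst_le (d n : ℕ) (U : ℕ → Ω → ℝ) (i : ℕ) (ω : Ω) :
    (optimalState d n U i ω).1 ≤ d := by
  induction i with
  | zero => exact Nat.zero_le d
  | succ i ih =>
    unfold optimalState
    split_ifs with h
    · by_contra hd
      have h2 := h.2
      rw [value_of_lt _ (not_le.mp hd)] at h2
      linarith [value_nonneg (n - (i + 1)) ih]
    · exact ih

variable [mΩ : MeasurableSpace Ω] {P : Measure Ω} {d n : ℕ} {G : ℕ → MeasurableSpace Ω}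
  {U : ℕ → Ω → ℝ}

namespace IsUniformStream

lemma measurableSet_optimalSelect_of (hU : IsUniformStream P n G U) {i : ℕ}
    (h : Measurable[G i] (optimalState d n U i)) :
    MeasurableSet[G (i + 1)] (optimalSelect d n U i) := by
  have hS : MeasurableSet {p : (ℕ × ℝ) × ℝ |
      value d (n - (i + 1)) p.1 < 1 + value d (n - (i + 1)) (step p.1 p.2)} :=
    measurableSet_lt ((measurable_value d _).comp measurable_fst)
      ((measurable_value_step d _).const_add 1)
  have hD : MeasurableSet {p : ℝ × ℝ | p.1 ≠ p.2} :=
    (measurableSet_eq_fun measurable_fst measurable_snd).compl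
  have hUj : ∀ j ≤ i, Measurable[G (i + 1)] (U j) := fun j hj =>
    (hU.measurable j).mono (hU.mono (Nat.succ_le_succ hj)) le_rfl
  have h1 : MeasurableSet[G (i + 1)] {ω | ∀ j < i, U j ω ≠ U i ω} := by
    have : {ω | ∀ j < i, U j ω ≠ U i ω} =
        ⋂ j, ⋂ (_ : j < i), (fun ω => (U j ω, U i ω)) ⁻¹' {p : ℝ × ℝ | p.1 ≠ p.2} := by
      ext ω; simp
    rw [this]
    exact MeasurableSet.iInter fun j => MeasurableSet.iInter fun hj =>
      ((hUj j hj.le).prodMk (hUj i le_rfl)) hD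
  have h2 : MeasurableSet[G (i + 1)] ((fun ω => (optimalState d n U i ω, U i ω)) ⁻¹' _) :=
    ((h.mono (hU.mono i.le_succ) le_rfl).prodMk (hU.measurable i)) hS
  exact ((@MeasurableSet.const _ (G (i + 1)) (i < n)).inter h1).inter h2

lemma measurableSet_optimalSelect (hU : IsUniformStream P n G U) (i : ℕ) :
    MeasurableSet[G (i + 1)] (optimalSelect d n U i) := by
  have h : ∀ i, Measurable[G i] (optimalState d n U i) := by
    intro i
    induction i with
    | zero => exact @measurable_const _ _ _ (G 0) _
    | succ i ih =>
      have h1 : Measurable[G (i + 1)] (optimalState d n U i) := ih.mono (hU.mono i.le_succ) le_rfl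
      exact Measurable.ite (hU.measurableSet_optimalSelect_of ih)
        (measurable_step.comp (h1.prodMk (hU.measurable i))) h1
  exact hU.measurableSet_optimalSelect_of (h i)

lemma ae_ne [IsProbabilityMeasure P] (hU : IsUniformStream P n G U) {i : ℕ} (hi : i < n) :
    ∀ᵐ ω ∂P, ∀ j < i, U j ω ≠ U i ω := by
  refine ae_all_iff.mpr fun j => ae_all_iff.mpr fun hj => ?_
  refine hU.ae_pair hi ((hU.measurable j).mono (hU.mono hj) le_rfl) (S := {p | p.1 ≠ p.2})
    (measurableSet_eq_fun measurable_fst measurable_snd).compl fun ω => ?_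
  filter_upwards [measure_eq_zero_iff_ae_notMem.mp (measure_singleton (μ := unif) (U j ω))]
    with u hu h
  exact hu h.symm

lemma ae_taken_optimalSelect [IsProbabilityMeasure P] (hU : IsUniformStream P n G U) {i : ℕ}
    (hi : i < n) :
    ∀ᵐ ω ∂P, taken d n U (optimalSelect d n U) i ω = bestAt d n U (optimalSelect d n U) i ω := by
  filter_upwards [hU.ae_ne hi] with ω hω
  unfold taken bestAt best
  rw [state_optimalSelect]
  split_ifs with h
  · exact (max_eq_right h.2.le).symm
  · refine (max_eq_left (not_lt.mp fun hlt => h ⟨⟨hi, hω⟩, hlt⟩)).symm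

end IsUniformStream

end

/-! ### Feasibility -/

section

variable {Ω : Type*} {d n : ℕ} {U : ℕ → Ω → ℝ} {A : ℕ → Set Ω} {ω : Ω}

lemma orient_le_orient_iff {r : ℕ} {u v : ℝ} :
    orient r u ≤ orient r v ↔ (Even r ∧ u ≤ v) ∨ (Odd r ∧ v ≤ u) := by
  by_cases h : Even r
  · simp [orient, h, Nat.not_odd_iff_even.mpr h]
  · simp only [orient, h, if_false, false_and, false_or, Nat.not_even_iff_odd.mp h, true_and]
    constructor <;> intro <;> linarith

/-- Opening a new block only when forced to is the most economical decomposition into blocks. -/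
lemma state_fst_le_of_isDModal (hU : ∀ i, 0 ≤ U i ω) (hA : ∀ i, n ≤ i → ω ∉ A i)
    (h : IsDModal d (fun i : Fin n => U i ω) {i | ω ∈ A i}) (i : ℕ) :
    (state U A i ω).1 ≤ d := by
  obtain ⟨b, hb, hmod⟩ := h
  have key : state U A i ω = (0, 0) ∨ ∃ l : Fin n, (l : ℕ) < i ∧ ω ∈ A l ∧
      (state U A i ω).1 ≤ b l ∧ (state U A i ω).2 = orient (state U A i ω).1 (U l ω) := by
    induction i with
    | zero => exact Or.inl rfl
    | succ i ih =>
      by_cases hi : ω ∈ A i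
      swap
      · rw [state_succ_of_notMem hi]
        exact ih.imp_right fun ⟨l, hl, h⟩ => ⟨l, hl.trans i.lt_succ_self, h⟩
      have hin : i < n := by
        by_contra hn
        exact hA i (not_lt.mp hn) hi
      refine Or.inr ⟨⟨i, hin⟩, i.lt_succ_self, hi, ?_, ?_⟩
      swap
      · rw [state_succ_of_mem hi]; exact step_snd _ _
      rw [state_succ_of_mem hi]
      rcases ih with h0 | ⟨l, hl, hlA, hlb, hls⟩
      · rw [h0, step_of_le (by simpa [orient] using hU i)]
        exact Nat.zero_le _
      have hbl : (b l : ℕ) ≤ b ⟨i, hin⟩ := hb (show l ≤ ⟨i, hin⟩ from hl.le)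
      rcases le_or_gt (state U A i ω).2 (orient (state U A i ω).1 (U i ω)) with hc | hc
      · rw [step_of_le hc]; exact hlb.trans hbl
      rw [step_of_lt hc]
      by_contra hlt
      -- both observations belong to the same block, which forbids a turn
      have e1 : (state U A i ω).1 = b l := by simp only at hlt; omega
      have e2 : b ⟨i, hin⟩ = b l := Fin.ext (by simp only at hlt; omega)
      refine hc.not_ge ?_
      rw [hls, orient_le_orient_iff, e1]
      have hm1 : l ∈ {i : Fin n | ω ∈ A i} ∩ b ⁻¹' {b l} := ⟨hlA, rfl⟩
      have hm2 : (⟨i, hin⟩ : Fin n) ∈ {i : Fin n | ω ∈ A i} ∩ b ⁻¹' {b l} := ⟨hi, e2⟩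
      rcases Nat.even_or_odd (b l : ℕ) with he | ho
      · exact Or.inl ⟨he, (hmod (b l)).1 he hm1 hm2 hl.le⟩
      · exact Or.inr ⟨ho, (hmod (b l)).2 ho hm1 hm2 hl.le⟩
  rcases key with h | ⟨l, -, -, h, -⟩
  · rw [h]; exact Nat.zero_le d
  · exact h.trans (Nat.lt_succ_iff.mp (b l).isLt)

lemma state_fst_mono : Monotone fun i => (state U A i ω).1 := by
  refine monotone_nat_of_le_succ fun i => ?_
  by_cases h : ω ∈ A i
  · rw [state_succ_of_mem h]
    rcases le_or_gt (state U A i ω).2 (orient (state U A i ω).1 (U i ω)) with hc | hc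
    · rw [step_of_le hc]
    · rw [step_of_lt hc]; exact Nat.le_succ _
  · rw [state_succ_of_notMem h]

lemma state_snd_le_of_fst_eq {i j : ℕ} (hij : i ≤ j)
    (h : (state U A j ω).1 = (state U A i ω).1) : (state U A i ω).2 ≤ (state U A j ω).2 := by
  induction j, hij using Nat.le_induction with
  | base => exact le_rfl
  | succ j hij ih =>
    have h1 : (state U A i ω).1 ≤ (state U A j ω).1 := state_fst_mono hij
    have h2 : (state U A j ω).1 ≤ (state U A (j + 1) ω).1 := state_fst_mono j.le_succ
    refine (ih (by omega)).trans ?_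
    by_cases hj : ω ∈ A j
    · rw [state_succ_of_mem hj] at h ⊢
      rcases le_or_gt (state U A j ω).2 (orient (state U A j ω).1 (U j ω)) with hc | hc
      · rwa [step_of_le hc]
      · rw [step_of_lt hc] at h
        simp only at h
        omega
    · rw [state_succ_of_notMem hj]

lemma isDModal_of_state {F : ℝ → ℝ} (hF : Monotone F) {x : Fin n → ℝ}
    (hx : ∀ i : Fin n, U i ω = F (x i)) (hd : ∀ i, (state U A i ω).1 ≤ d)
    (hne : ∀ i, ω ∈ A i → ∀ j < i, U j ω ≠ U i ω) : IsDModal d x {i | ω ∈ A i} := by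
  have key : ∀ i j : Fin n, ω ∈ A i → ω ∈ A j → i < j → ∀ r : ℕ,
      (state U A (i + 1) ω).1 = r → (state U A (j + 1) ω).1 = r →
      (Even r ∧ x i ≤ x j) ∨ (Odd r ∧ x j ≤ x i) := by
    intro i j hi hj hij r hir hjr
    have hs := state_snd_le_of_fst_eq (U := U) (A := A) (ω := ω)
      (Nat.succ_le_succ (Fin.le_def.mp hij.le)) (hjr.trans hir.symm)
    have ei : (state U A (i + 1) ω).2 = orient r (U i ω) := by
      rw [← hir, state_succ_of_mem hi]; exact step_snd _ _
    have ej : (state U A (j + 1) ω).2 = orient r (U j ω) := by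
      rw [← hjr, state_succ_of_mem hj]; exact step_snd _ _
    have hs' : orient r (U i ω) ≤ orient r (U j ω) := by rw [← ei, ← ej]; exact hs
    have hU := hne j hj i hij
    refine (orient_le_orient_iff.mp hs').imp (And.imp_right fun h => ?_)
      (And.imp_right fun h => ?_)
    · have := lt_of_le_of_ne h hU
      rw [hx, hx] at this
      exact (hF.reflect_lt this).le
    · have := lt_of_le_of_ne h hU.symm
      rw [hx, hx] at this
      exact (hF.reflect_lt this).le
  refine ⟨fun i => ⟨(state U A (i + 1) ω).1, Nat.lt_succ_of_le (hd _)⟩,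
    fun i j hij => state_fst_mono (Nat.succ_le_succ (Fin.le_def.mp hij)), fun r =>
    ⟨fun hr i hi j hj hij => ?_, fun hr i hi j hj hij => ?_⟩⟩
  all_goals
    rcases hij.eq_or_lt with rfl | hlt
    · exact le_rfl
    have := key i j hi.1 hj.1 hlt r (congrArg Fin.val hi.2) (congrArg Fin.val hj.2)
  · exact this.elim And.right fun h => absurd h.1 (Nat.not_odd_iff_even.mpr hr)
  · exact this.elim (fun h => absurd h.1 (Nat.not_even_iff_odd.mpr hr)) And.right

end

/-! ### The uniform stream of a sample -/

section

variable {Ω : Type*} [mΩ : MeasurableSpace Ω] {P : Measure Ω} [IsProbabilityMeasure P]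

/-- A random variable with a continuous distribution function `F` becomes uniform under `F`. -/
lemma map_comp_cdf {Y : Ω → ℝ} (hY : Measurable Y) {F : ℝ → ℝ} (hF : Continuous F)
    (h : ∀ x, P.real {ω | Y ω ≤ x} = F x) : P.map (fun ω => F (Y ω)) = unif := by
  have hprob : IsProbabilityMeasure (P.map Y) := Measure.isProbabilityMeasure_map hY.aemeasurable
  have hcdf : F = cdf (P.map Y) := by
    ext x
    rw [cdf_eq_real, map_measureReal_apply hY measurableSet_Iic, ← h]
    rfl
  have hmono : Monotone F := hcdf ▸ monotone_cdf _
  have hF0 : ∀ x, 0 ≤ F x := fun x => h x ▸ measureReal_nonneg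
  have hF1 : ∀ x, F x ≤ 1 := fun x => h x ▸ measureReal_le_one
  have hsurj : ∀ a ∈ Ioo (0 : ℝ) 1, ∃ x, F x = a := by
    intro a ha
    have hbot : Tendsto F atBot (𝓝 0) := hcdf ▸ tendsto_cdf_atBot _
    have htop : Tendsto F atTop (𝓝 1) := hcdf ▸ tendsto_cdf_atTop _
    obtain ⟨x, hx⟩ := ((tendsto_order.mp hbot).2 a ha.1).exists
    obtain ⟨y, hy⟩ := ((tendsto_order.mp htop).1 a ha.2).exists
    exact mem_range_of_exists_le_of_exists_ge hF ⟨x, hx.le⟩ ⟨y, hy.le⟩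
  have hFY : Measurable fun ω => F (Y ω) := hF.measurable.comp hY
  have : IsProbabilityMeasure (P.map fun ω => F (Y ω)) :=
    Measure.isProbabilityMeasure_map hFY.aemeasurable
  refine Measure.ext_of_Iic _ _ fun a => ?_
  rw [Measure.map_apply hFY measurableSet_Iic, unif, Measure.restrict_apply measurableSet_Iic]
  change P {ω | F (Y ω) ≤ a} = _
  rcases lt_or_ge a 0 with ha | ha
  · have e1 : {ω | F (Y ω) ≤ a} = ∅ :=
      eq_empty_of_forall_notMem fun ω hω => (ha.trans_le (hF0 (Y ω))).not_ge hω
    have e2 : Iic a ∩ Icc 0 1 = ∅ :=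
      eq_empty_of_forall_notMem fun x hx => (ha.trans_le hx.2.1).not_ge hx.1
    rw [e1, e2]; simp
  rcases le_or_gt 1 a with ha1 | ha1
  · have e1 : {ω | F (Y ω) ≤ a} = univ := eq_univ_of_forall fun ω => (hF1 _).trans ha1
    have e2 : Iic a ∩ Icc 0 1 = Icc 0 1 := inter_eq_right.mpr fun x hx => hx.2.trans ha1
    rw [e1, e2]; simp
  have e2 : Iic a ∩ Icc 0 1 = Icc 0 a := by
    ext x
    simp only [mem_inter_iff, mem_Iic, mem_Icc]
    constructor
    · rintro ⟨h1, h2, -⟩; exact ⟨h2, h1⟩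
    · rintro ⟨h1, h2⟩; exact ⟨h2, h1, h2.trans ha1.le⟩
  rw [e2, Real.volume_Icc, sub_zero, ← ofReal_measureReal]
  congr 1
  refine le_antisymm (le_of_forall_gt fun q hq => ?_) ?_
  · obtain ⟨b, hab, hb⟩ := exists_between (lt_min hq ha1)
    obtain ⟨x, rfl⟩ := hsurj b ⟨ha.trans_lt hab, hb.trans_le (min_le_right _ _)⟩
    refine lt_of_le_of_lt ?_ (hb.trans_le (min_le_left _ _))
    rw [← h x]
    exact measureReal_mono fun ω hω => (hmono.reflect_lt (lt_of_le_of_lt hω hab)).le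
  · rcases ha.eq_or_lt with rfl | ha0
    · exact measureReal_nonneg
    obtain ⟨x, rfl⟩ := hsurj a ⟨ha0, ha1⟩
    nth_rw 1 [← h x]
    exact measureReal_mono fun ω hω => hmono hω

end

section

variable {Ω : Type*} {n : ℕ}

/-- The σ-algebra generated by the observations before time `i`. -/
abbrev history (X : Fin n → Ω → ℝ) (i : ℕ) : MeasurableSpace Ω :=
  ⨆ j : Fin n, ⨆ _ : (j : ℕ) < i, MeasurableSpace.comap (X j) inferInstance

/-- The uniform observations `F (X i)`, continued by `0` after time `n`. -/
noncomputable def uniformized (F : ℝ → ℝ) (X : Fin n → Ω → ℝ) (i : ℕ) (ω : Ω) : ℝ :=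
  if h : i < n then F (X ⟨i, h⟩ ω) else 0

lemma uniformized_coe (F : ℝ → ℝ) (X : Fin n → Ω → ℝ) (i : Fin n) (ω : Ω) :
    uniformized F X i ω = F (X i ω) := by
  simp [uniformized]

lemma comap_le_history (X : Fin n → Ω → ℝ) {i : ℕ} {j : Fin n} (h : (j : ℕ) < i) :
    MeasurableSpace.comap (X j) inferInstance ≤ history X i :=
  le_iSup₂_of_le j h le_rfl

lemma isUniformStream [MeasurableSpace Ω] {P : Measure Ω} [IsProbabilityMeasure P]
    {F : ℝ → ℝ} (hF : Continuous F) {X : Fin n → Ω → ℝ} (hX : IsIIDSample X F P) :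
    IsUniformStream P n (history X) (uniformized F X) where
  mono i j hij := iSup₂_le fun l hl => comap_le_history X (hl.trans_le hij)
  le i := iSup₂_le fun l _ => (hX.measurable l).comap_le
  measurable i := by
    by_cases h : i < n
    · have h1 : Measurable[history X (i + 1)] (X ⟨i, h⟩) :=
        measurable_iff_comap_le.mpr (comap_le_history X i.lt_succ_self)
      have : uniformized F X i = fun ω => F (X ⟨i, h⟩ ω) := by
        ext ω; simp [uniformized, h]
      rw [this]
      exact hF.measurable.comp h1
    · have : uniformized F X i = fun _ => 0 := by
        ext ω; simp [uniformized, h]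
      rw [this]
      exact @measurable_const _ _ _ (history X (i + 1)) _
  mem i ω := by
    unfold uniformized
    split_ifs with h
    · rw [← hX.cdf_eq ⟨i, h⟩]
      exact ⟨measureReal_nonneg, measureReal_le_one⟩
    · exact ⟨le_rfl, zero_le_one⟩
  law i hi := by
    have : uniformized F X i = fun ω => F (X ⟨i, hi⟩ ω) := by
      ext ω; simp [uniformized, hi]
    rw [this]
    exact map_comp_cdf (hX.measurable _) hF (hX.cdf_eq _)
  indep i hi := by
    have hind := indep_iSup_of_disjoint (fun j => (hX.measurable j).comap_le) hX.indep
      (S := {j | (j : ℕ) < i}) (T := {⟨i, hi⟩})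
      (disjoint_singleton_right.mpr (by simp))
    refine indep_of_indep_of_le_right hind ?_
    have : uniformized F X i = F ∘ X ⟨i, hi⟩ := by
      ext ω; simp [uniformized, hi]
    rw [this, ← MeasurableSpace.comap_comp]
    exact le_iSup₂_of_le (⟨i, hi⟩ : Fin n) rfl (MeasurableSpace.comap_mono hF.measurable.comap_le)

/-! ### Selection policies -/

/-- The selection events of a policy, indexed by all times. -/
def events {X : Fin n → Ω → ℝ} {d : ℕ} (π : SelectionPolicy X d) (i : ℕ) : Set Ω :=
  {ω | ∃ h : i < n, ω ∈ π.select ⟨i, h⟩}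

variable {X : Fin n → Ω → ℝ} {d : ℕ}

lemma mem_events_coe (π : SelectionPolicy X d) (i : Fin n) (ω : Ω) :
    ω ∈ events π i ↔ ω ∈ π.select i := by
  simp [events]

lemma iSup_comap_eq_history (X : Fin n → Ω → ℝ) (i : Fin n) :
    ⨆ j : Fin n, ⨆ _ : j ≤ i, MeasurableSpace.comap (X j) inferInstance = history X (i + 1) := by
  simp only [history, Nat.lt_succ_iff, Fin.le_def]

lemma measurableSet_events (π : SelectionPolicy X d) (i : ℕ) :
    MeasurableSet[history X (i + 1)] (events π i) := by
  by_cases h : i < n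
  · have : events π i = π.select ⟨i, h⟩ := by ext ω; simp [events, h]
    rw [this, ← iSup_comap_eq_history X ⟨i, h⟩]
    exact π.nonanticipating ⟨i, h⟩
  · have : events π i = ∅ := by ext ω; simp [events, h]
    rw [this]
    exact @MeasurableSet.empty _ (history X (i + 1))

lemma length_eq_count (π : SelectionPolicy X d) (ω : Ω) :
    (π.length ω : ℝ) = count (events π) n ω := by
  classical
  rw [SelectionPolicy.length, Set.ncard_eq_toFinset_card', count, Finset.sum_range]
  simp only [indicator_apply, mem_events_coe, Pi.one_apply]
  rw [Finset.sum_boole]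
  congr 2
  ext i
  simp

/-- A monotone transformation of a feasible selection is feasible. -/
lemma state_events_fst_le {F : ℝ → ℝ} (hF : Monotone F) (hF0 : ∀ i ω, 0 ≤ uniformized F X i ω)
    (π : SelectionPolicy X d) (i : ℕ) (ω : Ω) :
    (state (uniformized F X) (events π) i ω).1 ≤ d := by
  refine state_fst_le_of_isDModal (n := n) (fun i => hF0 i ω) (fun i hi h => ?_) ?_ i
  · exact absurd h.1 hi.not_gt
  · obtain ⟨b, hb, h⟩ := π.feasible ω
    simp only [uniformized_coe, mem_events_coe]
    exact ⟨b, hb, fun r => ⟨fun hr => hF.comp_monotoneOn ((h r).1 hr),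
      fun hr => hF.comp_antitoneOn ((h r).2 hr)⟩⟩

/-- The policy that makes all decisions optimally. -/
def optimalPolicy {F : ℝ → ℝ} (hF : Monotone F) (X : Fin n → Ω → ℝ) (d : ℕ)
    (h : ∀ i, MeasurableSet[history X (i + 1)] (optimalSelect d n (uniformized F X) i)) :
    SelectionPolicy X d where
  select i := optimalSelect d n (uniformized F X) i
  nonanticipating i := by
    rw [iSup_comap_eq_history]
    exact h i
  feasible ω := isDModal_of_state hF (fun i => uniformized_coe F X i ω)
    (fun i => by rw [state_optimalSelect]; exact optimalState_fst_le d n _ i ω)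
    (fun i hi => hi.1.2)

lemma events_optimalPolicy {F : ℝ → ℝ} (hF : Monotone F)
    (h : ∀ i, MeasurableSet[history X (i + 1)] (optimalSelect d n (uniformized F X) i)) :
    events (optimalPolicy hF X d h) = optimalSelect d n (uniformized F X) := by
  ext i ω
  constructor
  · exact fun hω => hω.2
  · exact fun hω => ⟨hω.1.1, hω⟩

end

/-! ### Optimal policies and the weak law -/

section

variable {Ω : Type*} [mΩ : MeasurableSpace Ω] {P : Measure Ω} [IsProbabilityMeasure P]
  {d n : ℕ} {F : ℝ → ℝ} {X : Fin n → Ω → ℝ}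

/-- Without observations the distribution function is arbitrary, but it can then be changed. -/
lemma exists_monotone_cdf (hF : Continuous F) (hX : IsIIDSample X F P) :
    ∃ F' : ℝ → ℝ, Continuous F' ∧ Monotone F' ∧ IsIIDSample X F' P := by
  rcases n.eq_zero_or_pos with rfl | hn
  · exact ⟨fun _ => 0, continuous_const, monotone_const,
      hX.measurable, hX.indep, fun i => i.elim0⟩
  · refine ⟨F, hF, fun x y hxy => ?_, hX⟩
    rw [← hX.cdf_eq ⟨0, hn⟩ x, ← hX.cdf_eq ⟨0, hn⟩ y]
    exact measureReal_mono fun ω hω => le_trans hω hxy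

lemma integral_length_le (hF : Continuous F) (hmono : Monotone F) (hX : IsIIDSample X F P)
    (π : SelectionPolicy X d) : ∫ ω, (π.length ω : ℝ) ∂P ≤ value d n (0, 0) := by
  have hU := isUniformStream hF hX
  simp_rw [length_eq_count]
  exact hU.integral_count_le (measurableSet_events π)
    (state_events_fst_le hmono (fun i ω => (hU.mem i ω).1) π)

lemma exists_integral_length_eq (hF : Continuous F) (hmono : Monotone F)
    (hX : IsIIDSample X F P) :
    ∃ π : SelectionPolicy X d, ∫ ω, (π.length ω : ℝ) ∂P = value d n (0, 0) := by
  have hU := isUniformStream hF hX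
  have hA := hU.measurableSet_optimalSelect (d := d)
  refine ⟨optimalPolicy hmono X d hA, ?_⟩
  simp_rw [length_eq_count, events_optimalPolicy]
  refine (hU.integral_count_eq_iff hA fun i ω => ?_).mpr
    fun i hi => hU.ae_taken_optimalSelect hi
  rw [state_optimalSelect]
  exact optimalState_fst_le d n _ i ω

lemma exists_isOptimal (hF : Continuous F) (hX : IsIIDSample X F P) :
    ∃ π : SelectionPolicy X d, π.IsOptimal P := by
  obtain ⟨F', hF', hmono, hX'⟩ := exists_monotone_cdf hF hX
  obtain ⟨π, hπ⟩ := exists_integral_length_eq (d := d) hF' hmono hX'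
  exact ⟨π, fun π' => hπ ▸ integral_length_le hF' hmono hX' π'⟩

lemma integral_length_of_isOptimal (hF : Continuous F) (hX : IsIIDSample X F P)
    {π : SelectionPolicy X d} (hπ : π.IsOptimal P) :
    ∫ ω, (π.length ω : ℝ) ∂P = value d n (0, 0) := by
  obtain ⟨F', hF', hmono, hX'⟩ := exists_monotone_cdf hF hX
  obtain ⟨π', hπ'⟩ := exists_integral_length_eq (d := d) hF' hmono hX'
  exact le_antisymm (integral_length_le hF' hmono hX' π) (hπ' ▸ hπ π')

lemma ae_taken_of_isOptimal (hF : Continuous F) (hmono : Monotone F) (hX : IsIIDSample X F P)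
    {π : SelectionPolicy X d} (hπ : π.IsOptimal P) :
    ∀ i < n, ∀ᵐ ω ∂P, taken d n (uniformized F X) (events π) i ω =
      bestAt d n (uniformized F X) (events π) i ω := by
  have hU := isUniformStream hF hX
  refine (hU.integral_count_eq_iff (measurableSet_events π)
    (state_events_fst_le hmono (fun i ω => (hU.mem i ω).1) π)).mp ?_
  rw [← integral_length_of_isOptimal hF hX hπ]
  simp_rw [length_eq_count]

lemma ae_select_iff_of_isOptimal (hF : Continuous F) (hX : IsIIDSample X F P)
    {π π' : SelectionPolicy X d} (hπ : π.IsOptimal P) (hπ' : π'.IsOptimal P) :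
    ∀ᵐ ω ∂P, ∀ i, ω ∈ π.select i ↔ ω ∈ π'.select i := by
  obtain ⟨F, hF, hmono, hX⟩ := exists_monotone_cdf hF hX
  have hU := isUniformStream hF hX
  have hdet : ∀ π : SelectionPolicy X d, π.IsOptimal P → ∀ᵐ ω ∂P, ∀ i < n,
      (ω ∈ events π i ↔ value d (n - (i + 1)) (state (uniformized F X) (events π) i ω) <
        1 + value d (n - (i + 1))
          (step (state (uniformized F X) (events π) i ω) (uniformized F X i ω))) := fun π hπ =>
    ae_all_iff.mpr fun i => ae_all_iff.mpr fun hi => hU.ae_mem_iff (measurableSet_events π)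
      (state_events_fst_le hmono (fun i ω => (hU.mem i ω).1) π) hi
      (ae_taken_of_isOptimal hF hmono hX hπ i hi)
  filter_upwards [hdet π hπ, hdet π' hπ'] with ω h h'
  have hstate : ∀ i ≤ n, state (uniformized F X) (events π) i ω =
      state (uniformized F X) (events π') i ω := by
    intro i hi
    induction i with
    | zero => rfl
    | succ i ih =>
      have ih := ih (Nat.le_of_succ_le hi)
      have hiff : ω ∈ events π i ↔ ω ∈ events π' i := by rw [h i hi, h' i hi, ih]
      by_cases hm : ω ∈ events π i
      · rw [state_succ_of_mem hm, state_succ_of_mem (hiff.mp hm), ih]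
      · rw [state_succ_of_notMem hm, state_succ_of_notMem (mt hiff.mpr hm), ih]
  intro i
  rw [← mem_events_coe, ← mem_events_coe, h i i.isLt, h' i i.isLt, hstate i i.isLt.le]

lemma variance_length_le (hF : Continuous F) (hX : IsIIDSample X F P)
    {π : SelectionPolicy X d} (hπ : π.IsOptimal P) :
    variance (fun ω => (π.length ω : ℝ)) P ≤ ∫ ω, (π.length ω : ℝ) ∂P := by
  obtain ⟨F, hF, hmono, hX⟩ := exists_monotone_cdf hF hX
  have hU := isUniformStream hF hX
  simp_rw [length_eq_count]
  exact hU.variance_count_le (measurableSet_events π)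
    (state_events_fst_le hmono (fun i ω => (hU.mem i ω).1) π)
    (ae_taken_of_isOptimal hF hmono hX hπ)

lemma memLp_length (hF : Continuous F) (hX : IsIIDSample X F P) (π : SelectionPolicy X d) :
    MemLp (fun ω => (π.length ω : ℝ)) 2 P := by
  have hU := isUniformStream hF hX
  simp_rw [length_eq_count]
  exact MemLp.of_bound (hU.integrable_count (measurableSet_events π) n).aestronglyMeasurable n
    (Eventually.of_forall fun ω => abs_count_le _ n ω)

end

lemma tendstoInMeasure_length {Ω : Type*} [MeasurableSpace Ω] {P : Measure Ω}
    [IsProbabilityMeasure P] {F : ℝ → ℝ} (hF : Continuous F) {d : ℕ} {X : ℕ → Ω → ℝ}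
    (hX : IsIIDSample X F P) (π : (n : ℕ) → SelectionPolicy (fun i : Fin n => X i) d)
    (hπ : ∀ n, (π n).IsOptimal P) :
    TendstoInMeasure P (fun (n : ℕ) ω => ((π n).length ω : ℝ) / √(n : ℝ)) atTop
      (fun _ => √(2 * ((d : ℝ) + 1))) := by
  have hXn : ∀ n : ℕ, IsIIDSample (fun i : Fin n => X i) F P := fun n =>
    ⟨fun i => hX.measurable i, hX.indep.precomp Fin.val_injective, fun i => hX.cdf_eq i⟩
  have hlim := tendsto_value_div_sqrt d
  have hsq : Tendsto (fun n : ℕ => √(n : ℝ)) atTop atTop :=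
    Real.tendsto_sqrt_atTop.comp tendsto_natCast_atTop_atTop
  rw [tendstoInMeasure_iff_dist]
  intro ε hε
  have hbound : Tendsto (fun n : ℕ => ENNReal.ofReal
      (value d n (0, 0) / √(n : ℝ) * ((2 / ε) ^ 2 / √(n : ℝ)))) atTop (𝓝 0) := by
    have := hlim.mul (hsq.const_div_atTop ((2 / ε) ^ 2))
    rw [mul_zero] at this
    simpa using ENNReal.tendsto_ofReal this
  refine tendsto_of_tendsto_of_tendsto_of_le_of_le' tendsto_const_nhds hbound
    (Eventually.of_forall fun _ => zero_le) ?_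
  filter_upwards [(Metric.tendsto_nhds.mp hlim) (ε / 2) (half_pos hε), eventually_gt_atTop 0]
    with n hn hn0
  have hq : 0 < √(n : ℝ) := by
    have : (0 : ℝ) < n := by exact_mod_cast hn0
    positivity
  have hmean := integral_length_of_isOptimal hF (hXn n) (hπ n)
  have hvar := variance_length_le hF (hXn n) (hπ n)
  have hcheb := meas_ge_le_variance_div_sq (memLp_length hF (hXn n) (π n))
    (show 0 < ε / 2 * √(n : ℝ) by positivity)
  rw [hmean] at hcheb hvar
  refine (measure_mono fun ω hω => ?_).trans (hcheb.trans (ENNReal.ofReal_le_ofReal ?_))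
  · -- a deviation by `ε` from the limit is one by `ε / 2` from the mean
    have h1 : ε ≤ dist (((π n).length ω : ℝ) / √(n : ℝ)) (√(2 * ((d : ℝ) + 1))) := hω
    have h2 := dist_triangle (((π n).length ω : ℝ) / √(n : ℝ)) (value d n (0, 0) / √(n : ℝ))
      (√(2 * ((d : ℝ) + 1)))
    have h3 : ε / 2 ≤ dist (((π n).length ω : ℝ) / √(n : ℝ)) (value d n (0, 0) / √(n : ℝ)) := by
      linarith
    rw [Real.dist_eq, ← sub_div, abs_div, abs_of_pos hq, le_div_iff₀ hq] at h3
    exact h3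
  · calc _ ≤ value d n (0, 0) / (ε / 2 * √(n : ℝ)) ^ 2 := by gcongr
      _ = _ := by field_simp

end DModal

theorem mainTheorem7 {Ω : Type*} [MeasurableSpace Ω] (P : Measure Ω) [IsProbabilityMeasure P]
    (F : ℝ → ℝ) (hF : Continuous F) (d : ℕ) :
    (∀ (n : ℕ) (X : Fin n → Ω → ℝ), IsIIDSample X F P →
      (∃ π : SelectionPolicy X d, π.IsOptimal P) ∧
      (∀ π π' : SelectionPolicy X d, π.IsOptimal P → π'.IsOptimal P →
        ∀ᵐ ω ∂P, ∀ i, ω ∈ π.select i ↔ ω ∈ π'.select i) ∧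
      (∀ π : SelectionPolicy X d, π.IsOptimal P →
        variance (fun ω => (π.length ω : ℝ)) P ≤ ∫ ω, (π.length ω : ℝ) ∂P)) ∧
    (∀ X : ℕ → Ω → ℝ, IsIIDSample X F P →
      ∀ π : (n : ℕ) → SelectionPolicy (fun i : Fin n => X i) d, (∀ n, (π n).IsOptimal P) →
        TendstoInMeasure P (fun (n : ℕ) ω => ((π n).length ω : ℝ) / √(n : ℝ)) atTop
          (fun _ => √(2 * ((d : ℝ) + 1)))) := by
  exact ⟨fun _ _ hX => ⟨DModal.exists_isOptimal hF hX,
      fun _ _ hπ hπ' => DModal.ae_select_iff_of_isOptimal hF hX hπ hπ',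
      fun _ hπ => DModal.variance_length_le hF hX hπ⟩,
    fun _ hX π hπ => DModal.tendstoInMeasure_length hF hX π hπ⟩
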